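/- A polynomial probabilistic Petri net (polynomial pPN) consists of $d\in\mathbb N$ places and a finite set $\Delta\subseteq\mathbb N^d\times\mathbb N^d$ of transitions $t=(\mathbf{Pre}(t),\mathbf{Post}(t))$, each with a weight $W(t)\in\mathbb N[X_1,\dots,X_d]$ whose constant term is positive. A transition $t$ is enabled in a marking $\mathbf m\in\mathbb N^d$ if $\mathbf m\ge\mathbf{Pre}(t)$, and firing it leads to $\mathbf m-\mathbf{Pre}(t)+\mathbf{Post}(t)$. The associated Markov chain has state space $\mathbb N^d$: a marking with no enabled transition is absorbing; in any other marking $\mathbf m$, an enabled transition $t$ is chosen and fired with probability $W(t)(\mathbf m)\big/\sum_{t'\text{ enabled in }\mathbf m}W(t')(\mathbf m)$. For $\mathbf m_0\in\mathbb N^d$ and $A\subseteq\mathbb N^d$, the net is decisive with respect to $\mathbf m_0$ and $A$ if, with probability $0$, the infinite random path starting in $\mathbf m_0$ stays forever (time $0$ included) in markings that are outside $A$ and from which $A$ is reachable. Theorem. The following two decision problems are both undecidable. (1) Given a polynomial pPN, an initial marking $\mathbf m_0$ and a finite set $A$ of markings (given as a list), is the net decisive with respect to $\mathbf m_0$ and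 $A$? (2) Given a polynomial pPN, an initial marking $\mathbf m_0$ and an upward-closed set $A$ of markings (given as a finite list of markings whose upward closure is $A$), is the net decisive with respect to $\mathbf m_0$ and $A$? -/

import Mathlib

open MeasureTheory ProbabilityTheory

noncomputable section

/-! ### Markov chains, reachability, path measure, decisiveness -/

/-- A (discrete-time) Markov chain on the state space `S`. -/
structure MarkovChain (S : Type*) where
  /-- `p s` is the distribution of the successor of the state `s`. -/
  p : S → PMF S

namespace MarkovChain

variable {S : Type*}

/-- `s → s'`: the probability of going from `s` to `s'` in one step is positive. -/
def Step (M : MarkovChain S) (s s' : S) : Prop := 0 < M.p s s'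

/-- `A` is reachable from `s` (in zero or more steps); `s` satisfies `EF A`. -/
def CanReach (M : MarkovChain S) (s : S) (A : Set S) : Prop :=
  ∃ s' ∈ A, Relation.ReflTransGen M.Step s s'

variable [MeasurableSpace S] [DiscreteMeasurableSpace S]

/-- The one-step transition kernel. -/
def stepKernel (M : MarkovChain S) : Kernel S S where
  toFun s := (M.p s).toMeasure
  measurable' := Measurable.of_discrete

instance (M : MarkovChain S) : IsMarkovKernel M.stepKernel :=
  ⟨fun s => PMF.toMeasure.isProbabilityMeasure (M.p s)⟩

/-- The kernel producing the state at time `n + 1` from the states at times `0, …, n`: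
it only looks at the state at time `n`. -/
def historyKernel (M : MarkovChain S) (n : ℕ) : Kernel (Finset.Iic n → S) S :=
  M.stepKernel.comap (fun h => h ⟨n, Finset.mem_Iic.2 le_rfl⟩) (measurable_pi_apply _)

instance (M : MarkovChain S) (n : ℕ) : IsMarkovKernel (M.historyKernel n) := by
  unfold historyKernel; infer_instance

/-- The law of the infinite random path that starts in `s₀`, a probability measure on the
infinite sequences of states. -/
def pathMeasure (M : MarkovChain S) (s₀ : S) : Measure (ℕ → S) :=
  Kernel.traj (X := fun _ => S) M.historyKernel 0 (fun _ => s₀)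

/-- `M` is decisive w.r.t. `s₀` and `A`: the random path from `s₀` almost surely does not stay
forever among the states outside `A` from which `A` is reachable. -/
def Decisive (M : MarkovChain S) (s₀ : S) (A : Set S) : Prop :=
  M.pathMeasure s₀ {σ | ∀ i, σ i ∉ A ∧ M.CanReach (σ i) A} = 0

end MarkovChain

/-! ### Polynomial probabilistic Petri nets -/

/-- Markings of `d` places. -/
abbrev Marking (d : ℕ) := Fin d → ℕ

/-- A Petri net transition over `d` places. -/
@[ext] structure PetriTransition (d : ℕ) where
  /-- the tokens consumed -/
  pre : Marking d
  /-- the tokens produced -/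
  post : Marking d
deriving DecidableEq

/-- A probabilistic Petri net over `d` places with positive polynomial weights: a finite set of
transitions, each weighted by a polynomial in the place contents that has nonnegative
coefficients and a positive constant term (`weight` is relevant on `transitions` only). -/
structure PolyPPN (d : ℕ) where
  transitions : Finset (PetriTransition d)
  weight : PetriTransition d → MvPolynomial (Fin d) ℕ
  weight_pos : ∀ t ∈ transitions, 0 < (weight t).constantCoeff

namespace PolyPPN

variable {d : ℕ}

/-- The weight `W(t, m)` of the transition `t` in the marking `m`. -/
def W (N : PolyPPN d) (t : PetriTransition d) (m : Marking d) : ℕ :=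
  MvPolynomial.eval m (N.weight t)

/-- The transitions enabled in `m`. -/
def enabled (N : PolyPPN d) (m : Marking d) : Finset (PetriTransition d) :=
  N.transitions.filter fun t => ∀ i, t.pre i ≤ m i

/-- The marking reached by firing `t` in `m` (used for enabled `t` only). -/
def fire (t : PetriTransition d) (m : Marking d) : Marking d := m - t.pre + t.post

/-- The total weight of the transitions enabled in `m`. -/
def totalWeight (N : PolyPPN d) (m : Marking d) : ℕ := ∑ t ∈ N.enabled m, N.W t m

/-- One-step probabilities: a marking without enabled transition is absorbing; otherwise an
enabled transition is fired with probability proportional to its weight. -/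
def stepProb (N : PolyPPN d) (m m' : Marking d) : ENNReal :=
  if N.enabled m = ∅ then (if m' = m then 1 else 0)
  else (∑ t ∈ (N.enabled m).filter (fun t => fire t m = m'), (N.W t m : ENNReal)) /
    (N.totalWeight m : ENNReal)

theorem W_pos (N : PolyPPN d) {t : PetriTransition d} (ht : t ∈ N.transitions)
    (m : Marking d) : 0 < N.W t m := by
  have h := N.weight_pos t ht
  rw [MvPolynomial.constantCoeff_eq] at h
  rw [W, MvPolynomial.eval_eq]
  have h0 : (0 : Fin d →₀ ℕ) ∈ (N.weight t).support := by
    rw [MvPolynomial.mem_support_iff]; exact h.ne'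
  refine lt_of_lt_of_le h (le_trans ?_ (Finset.single_le_sum
    (f := fun e : Fin d →₀ ℕ => (N.weight t).coeff e * ∏ i ∈ e.support, m i ^ e i)
    (fun _ _ => Nat.zero_le _) h0))
  simp

theorem tsum_stepProb (N : PolyPPN d) (m : Marking d) : ∑' m', N.stepProb m m' = 1 := by
  unfold stepProb
  by_cases h : N.enabled m = ∅
  · simp [h]
  · simp only [h, if_false, div_eq_mul_inv, ENNReal.tsum_mul_right]
    have key : ∑' m', ∑ t ∈ (N.enabled m).filter (fun t => fire t m = m'), (N.W t m : ENNReal)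
        = (N.totalWeight m : ENNReal) := by
      simp only [Finset.sum_filter]
      rw [Summable.tsum_finsetSum (fun _ _ => ENNReal.summable)]
      simp [totalWeight]
    rw [key]
    refine ENNReal.mul_inv_cancel ?_ (ENNReal.natCast_ne_top _)
    obtain ⟨t, ht⟩ := Finset.nonempty_iff_ne_empty.2 h
    have hp : 0 < N.totalWeight m :=
      Finset.sum_pos (fun t ht => N.W_pos (Finset.mem_of_mem_filter t ht) m) ⟨t, ht⟩
    exact_mod_cast hp.ne'

/-- The Markov chain of a net, on its markings. -/
def markovChain (N : PolyPPN d) : MarkovChain (Marking d) where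
  p m := ⟨N.stepProb m, by
    have h := ENNReal.summable.hasSum (f := N.stepProb m)
    rwa [N.tsum_stepProb m] at h⟩

end PolyPPN

/-! ### Finite descriptions of nets, markings and target sets

Every description is meaningful, and every polynomial net, marking, finite set of markings and
upward-closed set of markings has a description. -/

/-- The vector of length `d` described by a list: its first `d` entries, missing ones being `0`. -/
def vecOf (d : ℕ) (l : List ℕ) : Fin d → ℕ := fun i => l.getD i 0

/-- A list of (coefficient, exponents): a polynomial with coefficients in `ℕ`. -/
abbrev PolyCode := List (ℕ × List ℕ)

/-- Consumed tokens, produced tokens, weight minus `1`. -/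
abbrev TransitionCode := (List ℕ × List ℕ) × PolyCode

/-- Number of places, list of weighted transitions. -/
abbrev NetCode := ℕ × List TransitionCode

/-- A net, an initial marking, a finite list of markings. -/
abbrev InstanceCode := (NetCode × List ℕ) × List (List ℕ)

/-- The polynomial described by a list of (coefficient, exponents). -/
def polyOf (d : ℕ) (c : PolyCode) : MvPolynomial (Fin d) ℕ :=
  (c.map fun a => MvPolynomial.monomial (Finsupp.equivFunOnFinite.symm (vecOf d a.2)) a.1).sum

/-- The (unweighted) transition described by a code. -/
def transitionOf (d : ℕ) (c : TransitionCode) : PetriTransition d :=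
  ⟨vecOf d c.1.1, vecOf d c.1.2⟩

/-- The net described by a code. The weights of repeated entries of a transition add up. -/
def netOf (c : NetCode) : PolyPPN c.1 where
  transitions := (c.2.map (transitionOf c.1)).toFinset
  weight t := ((c.2.filter fun a => transitionOf c.1 a = t).map fun a => 1 + polyOf c.1 a.2).sum
  weight_pos t ht := by
    obtain ⟨a, ha, rfl⟩ := List.mem_map.1 (List.mem_toFinset.1 ht)
    rw [map_list_sum, List.map_map]
    have ha' : a ∈ c.2.filter fun b => transitionOf c.1 b = transitionOf c.1 a := by simp [ha]
    have h1 := List.single_le_sum (fun _ _ => Nat.zero_le _) _ (List.mem_map_of_mem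
      (f := (MvPolynomial.constantCoeff ∘ fun a : TransitionCode => 1 + polyOf c.1 a.2)) ha')
    refine lt_of_lt_of_le ?_ h1
    simp

/-- The finite set of markings described by a list. -/
def finiteSetOf (d : ℕ) (L : List (List ℕ)) : Set (Marking d) := {m | ∃ l ∈ L, vecOf d l = m}

/-- The upward-closed set of markings generated by a finite list. -/
def upwardClosedSetOf (d : ℕ) (L : List (List ℕ)) : Set (Marking d) :=
  {m | ∃ l ∈ L, vecOf d l ≤ m}

theorem vecOf_ofFn {d : ℕ} (v : Fin d → ℕ) : vecOf d (List.ofFn v) = v := by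
  funext i
  simp [vecOf]

theorem exists_polyOf {d : ℕ} (P : MvPolynomial (Fin d) ℕ) : ∃ c, polyOf d c = P := by
  refine ⟨P.support.toList.map fun e => (P.coeff e, List.ofFn e), ?_⟩
  conv_rhs => rw [← P.support_sum_monomial_coeff]
  rw [← Finset.sum_map_toList, polyOf, List.map_map]
  congr 2
  funext e
  simp only [Function.comp_apply, vecOf_ofFn]
  congr 1
  ext i; simp

theorem exists_one_add_polyOf {d : ℕ} (P : MvPolynomial (Fin d) ℕ) (h : 0 < P.constantCoeff) :
    ∃ c, 1 + polyOf d c = P := by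
  rw [MvPolynomial.constantCoeff_eq] at h
  obtain ⟨c, hc⟩ := exists_polyOf (MvPolynomial.monomial 0 (P.coeff 0 - 1) +
    ∑ e ∈ P.support.erase 0, MvPolynomial.monomial e (P.coeff e))
  refine ⟨c, ?_⟩
  have h0 : (0 : Fin d →₀ ℕ) ∈ P.support := by
    rw [MvPolynomial.mem_support_iff]; exact h.ne'
  have h1 : (1 : MvPolynomial (Fin d) ℕ) = MvPolynomial.monomial 0 1 := rfl
  conv_rhs => rw [← P.support_sum_monomial_coeff, ← Finset.add_sum_erase _ _ h0]
  rw [hc, ← add_assoc, h1, ← map_add, Nat.add_sub_cancel' h]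

/-- Every net has a code. -/
theorem exists_netOf {d : ℕ} (N : PolyPPN d) : ∃ L : List TransitionCode,
    (netOf (d, L)).transitions = N.transitions ∧
      ∀ t ∈ N.transitions, (netOf (d, L)).weight t = N.weight t := by
  have h1 : ∀ t : PetriTransition d, ∃ c, t ∈ N.transitions → 1 + polyOf d c = N.weight t := by
    intro t
    by_cases ht : t ∈ N.transitions
    · obtain ⟨c, hc⟩ := exists_one_add_polyOf (N.weight t) (N.weight_pos t ht)
      exact ⟨c, fun _ => hc⟩
    · exact ⟨[], fun h => absurd h ht⟩
  choose pc hpc using h1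
  let g : PetriTransition d → TransitionCode := fun t => ((List.ofFn t.pre, List.ofFn t.post), pc t)
  have hg : ∀ t, transitionOf d (g t) = t := fun t => by simp [transitionOf, g, vecOf_ofFn]
  refine ⟨N.transitions.toList.map g, ?_, ?_⟩
  · ext t; simp [netOf, hg]
  · intro t ht
    have h2 : (N.transitions.toList.map g).filter (fun a => transitionOf d a = t) = [g t] := by
      rw [List.filter_map]
      have h3 : ((fun a => decide (transitionOf d a = t)) ∘ g) = fun s => decide (s = t) := by
        funext s; simp [hg]
      rw [h3, ← List.map_singleton (f := g)]
      congr 1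
      have h4 := N.transitions.nodup_toList
      have h5 : t ∈ N.transitions.toList := Finset.mem_toList.2 ht
      rw [List.filter_eq, List.count_eq_one_of_mem h4 h5, List.replicate_one]
    simp only [netOf, h2, List.map_cons, List.map_nil, List.sum_cons, List.sum_nil, add_zero]
    exact hpc t ht

end

/-!
Decisiveness of nets is shown undecidable by reducing the complement of the halting problem to it,
with the same net and the same single target marking for all instances; only the initial marking
depends on the instance.

Let `f` be a partial recursive function whose domain is undecidable. Its domain is recognized by a
nondeterministic counter program (`Prog.exists_prog_of_partrec`). The program is a regular
expression over the instructions "increment", "decrement, if positive" and "check for zero", and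
can terminate on the input `n` if and only if `f n` is defined. A Petri net cannot check for zero.
It can count to which extent it cheats: it first guesses a capacity `cap` and then keeps with each
counter `cnt` a complement `co` so that `cnt + co + held = cap`. A zero test moves tokens from
`co` to `held`, and then back; each token moved is counted in `sum`, each test in `tests`. Always
`sum ≤ cap * tests`, with equality only if every tested counter was zero. Hence the program can
terminate if and only if the net can reach its final control state with `sum = cap * tests`
(`Simulation.sum_lt_of_simulation`, `Simulation.exists_simulation`).

In the final control state a random walk starts, whose upward and downward steps have weights in
the ratio `2 * sum + 2 : 2 * cap * tests + 1`. As `sum` and `cap * tests` are integers, the two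
weights always differ: the walk drifts upwards if `sum = cap * tests` and downwards if
`sum < cap * tests`. When it is at zero, it has to be left. From all control states the net may give up,
leading to a control state `drain` in which all tokens are removed, until the target marking is
reached. So the target is reachable from every marking before, and what matters is whether the net
can avoid `drain` forever.

* While the program runs, the probability of giving up is bounded below, so that the program
  almost surely does not run forever. If the walk starts with `sum < cap * tests`, it almost
  surely is left or returns to zero. Both follow from Foster's criterion
  `MarkovChain.eq_zero_of_foster`, see `WalkNet.stay_run`. So the net is decisive if `f n` is
  undefined.
* The weights of the steps of the walk also contain a factor that grows quadratically with the
  number `clock` of steps made, so that the probabilities of giving up are summable. If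
  `sum = cap * tests` and the walk starts high enough, it goes on forever with positive probability, by the
  superharmonic bound `MarkovChain.one_le_stay_add`, see `WalkNet.stay_run_pos`. The starting
  point is guessed at the beginning. So the net is not decisive if `f n` is defined.

The target marking is zero on all data places, and its upward closure consists of the markings
with control `drain`, up to irrelevant markings with several control tokens. Since `drain` is
never left, the argument is the same for both kinds of target (`WalkNet.IsTarget`).

The probability of staying in a set forever is an integral over infinite paths; by the Markov
property it is the limit of the iterates of the one-step expectation
(`MarkovChain.pathMeasure_stay`), and only this description is used for nets.
-/

noncomputable section

/-! ### The probability of staying in a set forever -/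

namespace MarkovChain

variable {S : Type*} [MeasurableSpace S] [DiscreteMeasurableSpace S]

/-- The expected value of `f` after one step from `s`. -/
def next (M : MarkovChain S) (f : S → ENNReal) (s : S) : ENNReal := ∫⁻ s', f s' ∂M.stepKernel s

/-- The probability of being in `G` at the times `0, …, n`, as a function of the initial state. -/
def stayUntil (M : MarkovChain S) (G : Set S) (n : ℕ) : S → ENNReal :=
  G.indicator ((fun g => M.next (G.indicator g))^[n] 1)

/-- The limit of `stayUntil`: the probability of staying in `G` forever. -/
def stay (M : MarkovChain S) (G : Set S) (s : S) : ENNReal := ⨅ n, M.stayUntil G n s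

theorem next_mono (M : MarkovChain S) {f g : S → ENNReal} (h : f ≤ g) : M.next f ≤ M.next g :=
  fun _ => lintegral_mono h

theorem next_one (M : MarkovChain S) : M.next 1 = 1 := by
  funext s; simp [next]

theorem stayUntil_zero (M : MarkovChain S) (G : Set S) : M.stayUntil G 0 = G.indicator 1 := rfl

theorem stayUntil_succ (M : MarkovChain S) (G : Set S) (n : ℕ) :
    M.stayUntil G (n + 1) = G.indicator (M.next (M.stayUntil G n)) := by
  simp only [stayUntil, Function.iterate_succ_apply']

theorem stayUntil_le_one (M : MarkovChain S) (G : Set S) (n : ℕ) : M.stayUntil G n ≤ 1 := by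
  induction n with
  | zero => exact fun s => Set.indicator_le_self' (by simp) s
  | succ n ih =>
    rw [stayUntil_succ]
    refine le_trans (Set.indicator_le_self' (by simp)) ?_
    exact (M.next_mono ih).trans M.next_one.le

theorem stayUntil_antitone (M : MarkovChain S) (G : Set S) : Antitone (M.stayUntil G) := by
  refine antitone_nat_of_succ_le fun n => ?_
  induction n with
  | zero =>
    rw [stayUntil_succ, stayUntil_zero]
    refine fun s => Set.indicator_le_indicator ?_
    refine (M.next_mono (g := 1) ?_).trans M.next_one.le s
    exact Set.indicator_le_self' (by simp)
  | succ n ih =>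
    rw [stayUntil_succ M G (n + 1)]
    conv_rhs => rw [stayUntil_succ M G n]
    exact fun s => Set.indicator_le_indicator (M.next_mono ih s)

theorem stay_le_one (M : MarkovChain S) (G : Set S) (s : S) : M.stay G s ≤ 1 :=
  (iInf_le _ 0).trans (M.stayUntil_le_one G 0 s)

theorem stay_of_notMem (M : MarkovChain S) {G : Set S} {s : S} (hs : s ∉ G) : M.stay G s = 0 :=
  le_antisymm ((iInf_le _ 0).trans (by simp [stayUntil_zero, hs])) zero_le

/-- The probability of staying in `G` forever is harmonic on `G`. -/
theorem stay_of_mem (M : MarkovChain S) {G : Set S} {s : S} (hs : s ∈ G) :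
    M.stay G s = M.next (M.stay G) s := by
  have h1 : M.stay G = fun s => ⨅ n, M.stayUntil G n s := rfl
  rw [h1, next, lintegral_iInf (fun n => Measurable.of_discrete) (M.stayUntil_antitone G)]
  · have h2 : ∀ n, ∫⁻ s', M.stayUntil G n s' ∂M.stepKernel s = M.stayUntil G (n + 1) s := by
      intro n; rw [stayUntil_succ, Set.indicator_of_mem hs, next]
    simp only [h2]
    have h3 : Antitone fun n => M.stayUntil G n s := fun a b h => M.stayUntil_antitone G h s
    exact (h3.iInf_nat_add 1).symm
  · refine ne_top_of_le_ne_top ENNReal.one_ne_top (b := (1 : ENNReal)) ?_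
    exact (M.next_mono (M.stayUntil_le_one G 0) s).trans (M.next_one.le s)

/-- The Markov property at time `n`, for functions of the state at time `n + 1` on the event
that the first `n + 1` states lie in `G`. -/
theorem lintegral_pathMeasure_succ (M : MarkovChain S) (s₀ : S) (G : Set S) (n : ℕ)
    (g : S → ENNReal) :
    ∫⁻ σ, {σ : ℕ → S | ∀ i ≤ n + 1, σ i ∈ G}.indicator (fun σ => g (σ (n + 1))) σ
        ∂M.pathMeasure s₀ =
      ∫⁻ σ, {σ : ℕ → S | ∀ i ≤ n, σ i ∈ G}.indicator
        (fun σ => M.next (G.indicator g) (σ n)) σ ∂M.pathMeasure s₀ := by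
  let H : Set (Finset.Iic n → S) := {x | ∀ i, x i ∈ G}
  have hH : MeasurableSet H := by
    have : H = ⋂ i, (fun x : Finset.Iic n → S => x i) ⁻¹' G := by ext x; simp [H]
    rw [this]
    exact MeasurableSet.iInter fun i => (measurable_pi_apply i) (MeasurableSet.of_discrete)
  have hG : ∀ f : S → ENNReal, Measurable f := fun f => Measurable.of_discrete
  have key := Kernel.partialTraj_compProd_eq_map_traj (X := fun _ => S) (κ := M.historyKernel)
    (a := 0) (b := n) (Nat.zero_le n) (x₀ := fun _ => s₀)
  rw [← Kernel.traj_map_frestrictLe_apply] at key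
  have hF : Measurable fun z : (Finset.Iic n → S) × S =>
      H.indicator (1 : (Finset.Iic n → S) → ENNReal) z.1 * G.indicator g z.2 :=
    ((measurable_one.indicator hH).comp measurable_fst).mul
      ((hG (G.indicator g)).comp measurable_snd)
  have e1 := congrArg (fun μ => ∫⁻ z, H.indicator (1 : (Finset.Iic n → S) → ENNReal) z.1 *
    G.indicator g z.2 ∂μ) key
  beta_reduce at e1
  rw [Measure.lintegral_compProd hF, lintegral_map (Measurable.lintegral_kernel_prod_right' hF)
    (by fun_prop), lintegral_map hF (by fun_prop)] at e1
  symm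
  -- Both sides are integrals of `g` times the indicator of the cylinder event `H`: one over the
  -- product of the history and the next step, one over the whole path.
  convert e1 using 1
  · refine lintegral_congr fun σ => ?_
    dsimp only
    rw [lintegral_const_mul _ (hG _)]
    by_cases h : ∀ i ≤ n, σ i ∈ G
    · rw [Set.indicator_of_mem (by exact h), Set.indicator_of_mem]
      · simp [next, historyKernel, Kernel.comap_apply, Preorder.frestrictLe]
      · intro i; exact h i (Finset.mem_Iic.1 i.2)
    · rw [Set.indicator_of_notMem (by exact h), Set.indicator_of_notMem, zero_mul]
      intro h'
      exact h fun i hi => h' ⟨i, Finset.mem_Iic.2 hi⟩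
  · refine lintegral_congr fun σ => ?_
    dsimp only
    by_cases h : ∀ i ≤ n, σ i ∈ G
    · have hm : Preorder.frestrictLe (π := fun _ => S) n σ ∈ H :=
        fun i => h i (Finset.mem_Iic.1 i.2)
      rw [Set.indicator_of_mem hm]
      by_cases h1 : σ (n + 1) ∈ G
      · rw [Set.indicator_of_mem, Set.indicator_of_mem h1]
        · simp
        · intro i hi
          rcases Nat.le_succ_iff.1 hi with h2 | rfl
          exacts [h i h2, h1]
      · rw [Set.indicator_of_notMem, Set.indicator_of_notMem h1, mul_zero]
        exact fun h' => h1 (h' _ le_rfl)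
    · rw [Set.indicator_of_notMem, Set.indicator_of_notMem, zero_mul]
      · intro h'
        exact h fun i hi => h' ⟨i, Finset.mem_Iic.2 hi⟩
      · exact fun h' => h fun i hi => h' i (hi.trans n.le_succ)

/-- The initial state is deterministic. -/
theorem lintegral_pathMeasure_zero (M : MarkovChain S) (s₀ : S) (f : S → ENNReal) :
    ∫⁻ σ, f (σ 0) ∂M.pathMeasure s₀ = f s₀ := by
  have h : (fun σ : ℕ → S => f (σ 0)) =
      (fun x : Finset.Iic 0 → S => f (x ⟨0, by simp⟩)) ∘ Preorder.frestrictLe 0 := rfl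
  have hm : Measurable fun x : Finset.Iic 0 → S => f (x ⟨0, by simp⟩) :=
    (Measurable.of_discrete (f := f)).comp (measurable_pi_apply _)
  have e := lintegral_map (μ := M.pathMeasure s₀) hm
    (Preorder.measurable_frestrictLe (X := fun _ => S) 0)
  have e2 := Kernel.traj_map_frestrictLe_apply (X := fun _ => S) (κ := M.historyKernel) 0 0
    (fun _ => s₀)
  rw [Kernel.partialTraj_self, Kernel.id_apply] at e2
  rw [pathMeasure] at e ⊢
  rw [e2, lintegral_dirac' _ hm] at e
  exact e.symm

/-- Integrating over the path until time `n` is the same as iterating the one-step expectation. -/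
theorem lintegral_pathMeasure (M : MarkovChain S) (s₀ : S) (G : Set S) (n : ℕ)
    (g : S → ENNReal) :
    ∫⁻ σ, {σ : ℕ → S | ∀ i ≤ n, σ i ∈ G}.indicator (fun σ => g (σ n)) σ ∂M.pathMeasure s₀ =
      G.indicator ((fun g => M.next (G.indicator g))^[n] g) s₀ := by
  induction n generalizing g with
  | zero =>
    rw [← M.lintegral_pathMeasure_zero s₀ (G.indicator _)]
    refine lintegral_congr fun σ => ?_
    by_cases h : σ 0 ∈ G <;> simp [Set.indicator, h]
  | succ n ih => rw [lintegral_pathMeasure_succ, ih, Function.iterate_succ_apply]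

theorem pathMeasure_stay (M : MarkovChain S) (s₀ : S) (G : Set S) :
    M.pathMeasure s₀ {σ | ∀ i, σ i ∈ G} = M.stay G s₀ := by
  have hms : ∀ n, MeasurableSet {σ : ℕ → S | ∀ i ≤ n, σ i ∈ G} := by
    intro n
    have : {σ : ℕ → S | ∀ i ≤ n, σ i ∈ G} = ⋂ i, ⋂ (_ : i ≤ n), (fun σ : ℕ → S => σ i) ⁻¹' G := by
      ext x; simp
    rw [this]
    exact MeasurableSet.iInter fun i => MeasurableSet.iInter fun _ =>
      (measurable_pi_apply i) (MeasurableSet.of_discrete)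
  have h1 : {σ : ℕ → S | ∀ i, σ i ∈ G} = ⋂ n, {σ : ℕ → S | ∀ i ≤ n, σ i ∈ G} := by
    ext σ
    simp only [Set.mem_ofPred_eq, Set.mem_iInter]
    exact ⟨fun h n i _ => h i, fun h i => h i i le_rfl⟩
  have : IsProbabilityMeasure (M.pathMeasure s₀) := by unfold pathMeasure; infer_instance
  have hanti : Antitone fun n => {σ : ℕ → S | ∀ i ≤ n, σ i ∈ G} :=
    fun a b hab σ (h : ∀ i ≤ b, σ i ∈ G) i hi => h i (hi.trans hab)
  rw [h1, hanti.measure_iInter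
    (fun n => (hms n).nullMeasurableSet) ⟨0, measure_ne_top _ _⟩, stay]
  refine iInf_congr fun n => ?_
  rw [stayUntil, ← M.lintegral_pathMeasure s₀ G n 1, ← lintegral_indicator_one (hms n)]
  rfl

theorem decisive_iff (M : MarkovChain S) (s₀ : S) (A : Set S) :
    M.Decisive s₀ A ↔ M.stay {s | s ∉ A ∧ M.CanReach s A} s₀ = 0 := by
  rw [← pathMeasure_stay]; rfl

/-- Foster's criterion: a bounded function which is subharmonic on `G` and vanishes outside `G`
vanishes, if some finite nonnegative `V` decreases by at least `1` on average on `G`. Indeed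
`n * f ≤ V` for all `n`. -/
theorem eq_zero_of_foster (M : MarkovChain S) {G : Set S} {f : S → ENNReal} (hf : f ≤ 1)
    (hsub : ∀ s ∈ G, f s ≤ M.next (G.indicator f) s) {V : S → ENNReal}
    (hV : ∀ s ∈ G, 1 + M.next (G.indicator V) s ≤ V s) (hV' : ∀ s ∈ G, V s ≠ ⊤)
    {s : S} (hs : s ∈ G) : f s = 0 := by
  have key : ∀ n : ℕ, ∀ s ∈ G, n * f s ≤ V s := by
    intro n
    induction n with
    | zero => simp
    | succ n ih =>
      intro s hs
      have h1 : (n : ENNReal) * M.next (G.indicator f) s ≤ M.next (G.indicator V) s := by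
        rw [next, next, ← lintegral_const_mul _ Measurable.of_discrete]
        refine lintegral_mono fun t => ?_
        by_cases ht : t ∈ G
        · simpa [ht] using ih t ht
        · simp [ht]
      calc ((n + 1 : ℕ) : ENNReal) * f s = f s + n * f s := by push_cast; ring
        _ ≤ 1 + n * M.next (G.indicator f) s := by
          gcongr
          exacts [hf s, hsub s hs]
        _ ≤ 1 + M.next (G.indicator V) s := by gcongr
        _ ≤ V s := hV s hs
  by_contra h0
  obtain ⟨n, hn⟩ := ENNReal.exists_nat_mul_gt h0 (hV' s hs)
  exact absurd (key n s hs) (not_le.2 hn)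

/-- If `h` is superharmonic on `G` and at least `1` outside `G`, the probability of leaving `G` is
at most `h`. -/
theorem one_le_stay_add (M : MarkovChain S) {G : Set S} {h : S → ENNReal}
    (hh : ∀ s ∈ G, M.next h s ≤ h s) (hout : ∀ s ∉ G, 1 ≤ h s) (s : S) :
    1 ≤ M.stay G s + h s := by
  rw [stay, ENNReal.iInf_add]
  refine le_iInf fun n => ?_
  induction n generalizing s with
  | zero =>
    by_cases hs : s ∈ G
    · simp [stayUntil_zero, hs]
    · exact (hout s hs).trans le_add_self
  | succ n ih =>
    by_cases hs : s ∈ G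
    · rw [stayUntil_succ, Set.indicator_of_mem hs]
      calc (1 : ENNReal) = M.next 1 s := by rw [next_one]; rfl
        _ ≤ M.next (fun t => M.stayUntil G n t + h t) s := M.next_mono (fun t => ih t) s
        _ = M.next (M.stayUntil G n) s + M.next h s := by
          rw [next, next, next, lintegral_add_left Measurable.of_discrete]
        _ ≤ _ := by gcongr; exact hh s hs
    · exact (hout s hs).trans le_add_self

theorem stay_mono (M : MarkovChain S) {G G' : Set S} (h : G ⊆ G') : M.stay G ≤ M.stay G' := by
  intro s
  rw [← pathMeasure_stay, ← pathMeasure_stay]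
  exact measure_mono fun σ hσ i => h (hσ i)

theorem mul_le_next (M : MarkovChain S) (f : S → ENNReal) (s t : S) :
    M.p s t * f t ≤ M.next f s := by
  have h1 : M.stepKernel s {t} = M.p s t :=
    PMF.toMeasure_apply_singleton _ _ (measurableSet_singleton t)
  rw [← h1, mul_comm]
  calc f t * M.stepKernel s {t} = ∫⁻ _ in {t}, f t ∂M.stepKernel s := by
        rw [setLIntegral_const]
    _ = ∫⁻ x in {t}, f x ∂M.stepKernel s :=
        setLIntegral_congr_fun (measurableSet_singleton t) fun x hx => by
          rw [Set.mem_singleton_iff.1 hx]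
    _ ≤ M.next f s := setLIntegral_le_lintegral _ _

theorem stay_pos_of_step (M : MarkovChain S) {G : Set S} {s t : S} (hs : s ∈ G) (h : M.Step s t)
    (ht : 0 < M.stay G t) : 0 < M.stay G s := by
  rw [stay_of_mem M hs]
  exact (ENNReal.mul_pos h.ne' ht.ne').trans_le (M.mul_le_next _ _ _)

end MarkovChain

/-! ### Petri nets with finite control -/

namespace PolyPPN

variable {d : ℕ}

/-- The Markov chain does not depend on the weights of pairs that are not transitions. -/
theorem markovChain_congr {N N' : PolyPPN d} (ht : N.transitions = N'.transitions)
    (hw : ∀ t ∈ N.transitions, N.weight t = N'.weight t) : N.markovChain = N'.markovChain := by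
  have he : N.enabled = N'.enabled := by funext m; simp [enabled, ht]
  have hW : ∀ m, ∀ t ∈ N.enabled m, N.W t m = N'.W t m := fun m t h => by
    rw [W, W, hw t (Finset.mem_of_mem_filter t h)]
  have hs : N.stepProb = N'.stepProb := by
    funext m m'
    have h1 : N.totalWeight m = N'.totalWeight m := by
      rw [totalWeight, totalWeight, ← he]
      exact Finset.sum_congr rfl (hW m)
    have h2 : ∑ t ∈ (N.enabled m).filter (fun t => fire t m = m'), (N.W t m : ENNReal) =
        ∑ t ∈ (N'.enabled m).filter (fun t => fire t m = m'), (N'.W t m : ENNReal) := by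
      rw [← he]
      exact Finset.sum_congr rfl fun t ht => by rw [hW m t (Finset.mem_of_mem_filter t ht)]
    rw [stepProb, stepProb, h1, h2, he]
  simp only [markovChain, hs]

theorem next_eq (N : PolyPPN d) (F : Marking d → ENNReal) {m : Marking d}
    (h : (N.enabled m).Nonempty) :
    N.markovChain.next F m =
      (∑ t ∈ N.enabled m, (N.W t m : ENNReal) * F (fire t m)) / (N.totalWeight m : ENNReal) := by
  have h1 : ∀ m', N.markovChain.stepKernel m {m'} = N.stepProb m m' := fun m' =>
    PMF.toMeasure_apply_singleton _ _ (measurableSet_singleton m')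
  rw [MarkovChain.next, lintegral_countable']
  simp only [h1, stepProb, h.ne_empty, if_false, div_eq_mul_inv, ← mul_assoc,
    ENNReal.tsum_mul_right]
  congr 1
  simp only [Finset.sum_filter, Finset.mul_sum]
  rw [Summable.tsum_finsetSum (fun _ _ => ENNReal.summable)]
  refine Finset.sum_congr rfl fun t _ => ?_
  rw [tsum_eq_single (fire t m)]
  · simp [mul_comm]
  · intro m' hm'; simp [hm'.symm]

theorem step_fire (N : PolyPPN d) {m : Marking d} {t : PetriTransition d} (h : t ∈ N.enabled m) :
    N.markovChain.Step m (fire t m) := by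
  change 0 < N.stepProb m (fire t m)
  rw [stepProb, if_neg (Finset.ne_empty_of_mem h)]
  refine ENNReal.div_pos ?_ (ENNReal.natCast_ne_top _)
  have h1 : t ∈ (N.enabled m).filter (fun s => fire s m = fire t m) := by simp [h]
  refine (lt_of_lt_of_le ?_ (Finset.single_le_sum (f := fun t => (N.W t m : ENNReal))
    (fun _ _ => zero_le) h1)).ne'
  exact_mod_cast N.W_pos (Finset.mem_of_mem_filter t h) m

end PolyPPN

/-- A transition of a Petri net with finite control: it moves the control from `src` to `tgt`,
consumes the tokens `pre` and produces the tokens `post`. -/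
@[ext] structure Rule (C D : Type*) where
  src : C
  pre : D → ℕ
  tgt : C
  post : D → ℕ

namespace Rule

variable {C D : Type*} [DecidableEq C] {d : ℕ}

/-- The marking with one token on the control place `κ` and data `δ`, when the control places and
the data places are numbered by `e`. -/
def marking (e : C ⊕ D ≃ Fin d) (κ : C) (δ : D → ℕ) : Marking d :=
  fun j => Sum.elim (Pi.single κ 1) δ (e.symm j)

theorem marking_le_iff (e : C ⊕ D ≃ Fin d) {κ κ' : C} {δ δ' : D → ℕ} :
    marking e κ δ ≤ marking e κ' δ' ↔ κ = κ' ∧ δ ≤ δ' := by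
  constructor
  · intro h
    constructor
    · by_contra hne
      have := h (e (Sum.inl κ))
      simp [marking, hne] at this
    · intro p
      simpa [marking] using h (e (Sum.inr p))
  · rintro ⟨rfl, h⟩ j
    unfold marking
    rcases e.symm j with c | p
    · exact le_rfl
    · exact h p

theorem marking_inj (e : C ⊕ D ≃ Fin d) {κ κ' : C} {δ δ' : D → ℕ} :
    marking e κ δ = marking e κ' δ' ↔ κ = κ' ∧ δ = δ' := by
  refine ⟨fun h => ?_, by rintro ⟨rfl, rfl⟩; rfl⟩
  have h1 := (marking_le_iff e).1 h.le
  have h2 := (marking_le_iff e).1 h.ge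
  exact ⟨h1.1, le_antisymm h1.2 h2.2⟩

/-- The Petri net transition of a rule. -/
def toTransition (e : C ⊕ D ≃ Fin d) (r : Rule C D) : PetriTransition d :=
  ⟨marking e r.src r.pre, marking e r.tgt r.post⟩

theorem toTransition_injective (e : C ⊕ D ≃ Fin d) :
    Function.Injective (toTransition e) := by
  intro r r' h
  have h1 := (marking_inj e).1 (congrArg PetriTransition.pre h)
  have h2 := (marking_inj e).1 (congrArg PetriTransition.post h)
  exact Rule.ext h1.1 h1.2 h2.1 h2.2

theorem fire_toTransition (e : C ⊕ D ≃ Fin d) (r : Rule C D) (δ : D → ℕ) :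
    PolyPPN.fire (toTransition e r) (marking e r.src δ) =
      marking e r.tgt (δ - r.pre + r.post) := by
  funext j
  simp only [PolyPPN.fire, toTransition, marking, Pi.add_apply, Pi.sub_apply]
  rcases e.symm j with c | p <;> simp

open Classical in
/-- The net with the rules `R`, weighted by polynomials in the data. The weight of a pair that does
not come from a rule is irrelevant. -/
def net (e : C ⊕ D ≃ Fin d) (R : Finset (Rule C D)) (w : Rule C D → MvPolynomial D ℕ)
    (hw : ∀ r ∈ R, 0 < (w r).constantCoeff) : PolyPPN d where
  transitions := R.image (toTransition e)
  weight := Function.extend (toTransition e)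
    (fun r => MvPolynomial.rename (fun p => e (Sum.inr p)) (w r)) 1
  weight_pos t ht := by
    obtain ⟨r, hr, rfl⟩ := Finset.mem_image.1 ht
    rw [(toTransition_injective e).extend_apply, MvPolynomial.constantCoeff_rename]
    exact hw r hr

variable (e : C ⊕ D ≃ Fin d) (R : Finset (Rule C D)) (w : Rule C D → MvPolynomial D ℕ)
  (hw : ∀ r ∈ R, 0 < (w r).constantCoeff)

open Classical in
/-- The rules of `R` that can be applied with control `κ` and data `δ`. -/
def enabledRules (R : Finset (Rule C D)) (κ : C) (δ : D → ℕ) : Finset (Rule C D) :=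
  R.filter fun r => r.src = κ ∧ r.pre ≤ δ

theorem mem_enabledRules {R : Finset (Rule C D)} {κ : C} {δ : D → ℕ} {r : Rule C D} :
    r ∈ enabledRules R κ δ ↔ r ∈ R ∧ r.src = κ ∧ r.pre ≤ δ := by
  simp [enabledRules]

open Classical in
theorem enabled_net (κ : C) (δ : D → ℕ) :
    (net e R w hw).enabled (marking e κ δ) = (enabledRules R κ δ).image (toTransition e) := by
  ext t
  simp only [PolyPPN.enabled, net, Finset.mem_filter, Finset.mem_image, mem_enabledRules]
  constructor
  · rintro ⟨⟨r, hr, rfl⟩, h⟩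
    exact ⟨r, ⟨hr, (marking_le_iff e).1 h⟩, rfl⟩
  · rintro ⟨r, ⟨hr, h⟩, rfl⟩
    exact ⟨⟨r, hr, rfl⟩, (marking_le_iff e).2 h⟩

theorem W_net (r : Rule C D) (κ : C) (δ : D → ℕ) :
    (net e R w hw).W (toTransition e r) (marking e κ δ) = MvPolynomial.eval δ (w r) := by
  rw [PolyPPN.W, net]
  dsimp only
  rw [(toTransition_injective e).extend_apply, MvPolynomial.eval_rename]
  congr 2
  funext p
  simp [marking]

/-- The one-step expectation of a net with finite control. -/
theorem next_net (F : Marking d → ENNReal) {κ : C} {δ : D → ℕ}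
    (h : (enabledRules R κ δ).Nonempty) :
    (net e R w hw).markovChain.next F (marking e κ δ) =
      (∑ r ∈ enabledRules R κ δ,
        (MvPolynomial.eval δ (w r) : ENNReal) * F (marking e r.tgt (δ - r.pre + r.post))) /
      ((∑ r ∈ enabledRules R κ δ, MvPolynomial.eval δ (w r) : ℕ) : ENNReal) := by
  classical
  have hinj : Set.InjOn (toTransition e) (enabledRules R κ δ : Set (Rule C D)) :=
    (toTransition_injective e).injOn
  rw [PolyPPN.next_eq _ _ (by rw [enabled_net]; exact h.image _), PolyPPN.totalWeight,
    enabled_net, Finset.sum_image hinj, Finset.sum_image hinj]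
  congr 1
  · refine Finset.sum_congr rfl fun r hr => ?_
    rw [W_net, ← (mem_enabledRules.1 hr).2.1, fire_toTransition]
  · simp only [W_net]

theorem step_net {r : Rule C D} (hr : r ∈ R) {δ : D → ℕ} (h : r.pre ≤ δ) :
    (net e R w hw).markovChain.Step (marking e r.src δ)
      (marking e r.tgt (δ - r.pre + r.post)) := by
  classical
  rw [← fire_toTransition]
  apply PolyPPN.step_fire
  rw [enabled_net]
  exact Finset.mem_image_of_mem _ (mem_enabledRules.2 ⟨hr, rfl, h⟩)

/-- An upper bound on a one-step expectation, from an inequality between weighted sums. -/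
theorem next_net_le {F : Marking d → ENNReal} {κ : C} {δ : D → ℕ} {v : Rule C D → ℝ} {B : ℝ}
    (h : (enabledRules R κ δ).Nonempty)
    (hv : ∀ r ∈ enabledRules R κ δ, 0 ≤ v r)
    (hF : ∀ r ∈ enabledRules R κ δ,
      F (marking e r.tgt (δ - r.pre + r.post)) ≤ ENNReal.ofReal (v r))
    (hB : ∑ r ∈ enabledRules R κ δ, (MvPolynomial.eval δ (w r) : ℝ) * v r ≤
      (∑ r ∈ enabledRules R κ δ, (MvPolynomial.eval δ (w r) : ℝ)) * B) :
    (net e R w hw).markovChain.next F (marking e κ δ) ≤ ENNReal.ofReal B := by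
  rw [next_net e R w hw F h]
  have h1 : (0 : ℝ) ≤ ∑ r ∈ enabledRules R κ δ, (MvPolynomial.eval δ (w r) : ℝ) :=
    Finset.sum_nonneg fun _ _ => Nat.cast_nonneg _
  refine ENNReal.div_le_of_le_mul' ?_
  calc _ ≤ ∑ r ∈ enabledRules R κ δ,
        ENNReal.ofReal ((MvPolynomial.eval δ (w r) : ℝ) * v r) := by
        refine Finset.sum_le_sum fun r hr => ?_
        rw [ENNReal.ofReal_mul (Nat.cast_nonneg _), ENNReal.ofReal_natCast]
        gcongr
        exact hF r hr
    _ = ENNReal.ofReal (∑ r ∈ enabledRules R κ δ, (MvPolynomial.eval δ (w r) : ℝ) * v r) :=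
        (ENNReal.ofReal_sum_of_nonneg fun r hr =>
          mul_nonneg (Nat.cast_nonneg _) (hv r hr)).symm
    _ ≤ _ := ENNReal.ofReal_le_ofReal hB
    _ = _ := by rw [ENNReal.ofReal_mul h1, ← Nat.cast_sum, ENNReal.ofReal_natCast]

theorem next_net_mono {F F' : Marking d → ENNReal} {κ : C} {δ : D → ℕ}
    (h : (enabledRules R κ δ).Nonempty)
    (hF : ∀ r ∈ enabledRules R κ δ,
      F (marking e r.tgt (δ - r.pre + r.post)) ≤ F' (marking e r.tgt (δ - r.pre + r.post))) :
    (net e R w hw).markovChain.next F (marking e κ δ) ≤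
      (net e R w hw).markovChain.next F' (marking e κ δ) := by
  rw [next_net e R w hw F h, next_net e R w hw F' h]
  gcongr with r hr
  exact hF r hr

/-- One step of a net with finite control, on pairs of a control state and data. -/
def RunStep (E : Set (Rule C D)) (a b : C × (D → ℕ)) : Prop :=
  ∃ r ∈ E, r.src = a.1 ∧ r.pre ≤ a.2 ∧ r.tgt = b.1 ∧ b.2 = a.2 - r.pre + r.post

/-- The runs of a net with finite control. -/
def Run (E : Set (Rule C D)) : C × (D → ℕ) → C × (D → ℕ) → Prop :=
  Relation.ReflTransGen (RunStep E)

end Rule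

/-! ### A net that runs a program and then a random walk -/

/-- The data places of the net that simulates a program with `k` counters. The counter `i` is the
place `cnt i`; together with `co i` and `held i` it always holds `cap` tokens. The place `tests`
counts the zero tests, `sum` the tokens moved during zero tests, `walk` is the position of the
final random walk and `clock` the number of its steps. -/
inductive Place (k : ℕ)
  | cap | sum | tests | walk | clock
  | cnt (i : Fin k) | co (i : Fin k) | held (i : Fin k)
deriving DecidableEq, Fintype

namespace WalkNet

open Rule Place

variable {k : ℕ} {Q : Type}

/-- The control states of the simulating net: those of the program, and one state for each of the
two final phases. -/
inductive Ctl (Q : Type)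
  | run (q : Q)
  | walking
  | drain
deriving DecidableEq, Fintype

/-- The transitions of the simulating net. -/
abbrev NetRule (k : ℕ) (Q : Type) := Rule (Ctl Q) (Place k)

/-- A transition of the program, as a transition of the net. -/
def lift (r : Rule Q (Place k)) : NetRule k Q := ⟨.run r.src, r.pre, .run r.tgt, r.post⟩

/-- The program may be given up in any of its control states. -/
def giveUp (q : Q) : NetRule k Q := ⟨.run q, 0, .drain, 0⟩

/-- The program ends in `t` and the random walk starts. -/
def halt (t : Q) : NetRule k Q := ⟨.run t, 0, .walking, 0⟩

/-- An upward step of the random walk. -/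
def up : NetRule k Q :=
  ⟨.walking, Pi.single walk 1, .walking, Pi.single walk 2 + Pi.single clock 1⟩

/-- A downward step of the random walk. -/
def down : NetRule k Q := ⟨.walking, Pi.single walk 1, .walking, Pi.single clock 1⟩

/-- The random walk may be left at any time, and it has to be left at zero. -/
def exit : NetRule k Q := ⟨.walking, 0, .drain, 0⟩

/-- Once the outcome is settled, all tokens on the data places are removed. -/
def remove (p : Place k) : NetRule k Q := ⟨.drain, Pi.single p 1, .drain, 0⟩

open Classical in
/-- The weights: an upward step of the random walk has weight proportional to `2 * sum + 2` and a
downward step to `2 * cap * tests + 1`. Both grow quadratically with the time, so that leaving the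
walk, of weight `1`, has summable probabilities. -/
def weight (r : NetRule k Q) : MvPolynomial (Place k) ℕ :=
  if r = up then (2 * .X sum + 2) * ((1 + .X clock) * (2 + .X clock))
  else if r = down then (2 * .X cap * .X tests + 1) * ((1 + .X clock) * (2 + .X clock))
  else 1

theorem weight_pos (r : NetRule k Q) : 0 < (weight r).constantCoeff := by
  unfold weight
  have h2 : (2 : MvPolynomial (Place k) ℕ).constantCoeff = 2 := map_ofNat _ 2
  split_ifs <;> simp [h2]

theorem up_ne_down : (up : NetRule k Q) ≠ down := by
  intro h
  have := congrFun (congrArg Rule.post h) walk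
  simp [up, down] at this

theorem weight_up : weight (up : NetRule k Q) =
    (2 * .X sum + 2) * ((1 + .X clock) * (2 + .X clock)) := by simp [weight]

theorem weight_down : weight (down : NetRule k Q) =
    (2 * .X cap * .X tests + 1) * ((1 + .X clock) * (2 + .X clock)) := by
  simp [weight, up_ne_down.symm]

theorem weight_exit : weight (exit : NetRule k Q) = 1 := by
  simp [weight, up, down, exit, Rule.ext_iff]

theorem weight_run {r : NetRule k Q} {q : Q} (h : r.src = .run q) : weight r = 1 := by
  have h1 : r ≠ up := by rintro rfl; simp [up] at h
  have h2 : r ≠ down := by rintro rfl; simp [down] at h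
  simp [weight, h1, h2]

theorem single_le_iff {p : Place k} {δ : Place k → ℕ} : Pi.single p 1 ≤ δ ↔ δ p ≠ 0 := by
  constructor
  · intro h
    simpa [Nat.one_le_iff_ne_zero] using h p
  · intro h x
    by_cases hx : x = p
    · subst hx; simpa [Nat.one_le_iff_ne_zero] using h
    · simp [hx]

theorem sum_sub_single_lt {p : Place k} {δ : Place k → ℕ} (h : δ p ≠ 0) :
    ∑ x, (δ - Pi.single p 1 + 0 : Place k → ℕ) x < ∑ x, δ x := by
  refine Finset.sum_lt_sum (fun x _ => by simp) ⟨p, Finset.mem_univ _, ?_⟩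
  simp
  omega

theorem up_data {δ : Place k → ℕ} (h : δ walk ≠ 0) :
    δ - (up : NetRule k Q).pre + (up : NetRule k Q).post =
      Function.update (Function.update δ walk (δ walk + 1)) clock (δ clock + 1) := by
  funext p
  cases p <;> simp [up]
  omega

theorem down_data {δ : Place k → ℕ} :
    δ - (down : NetRule k Q).pre + (down : NetRule k Q).post =
      Function.update (Function.update δ walk (δ walk - 1)) clock (δ clock + 1) := by
  funext p
  cases p <;> simp [down]

theorem eval_weight_up (δ : Place k → ℕ) :
    (MvPolynomial.eval δ (weight (up : NetRule k Q)) : ℝ) =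
      (2 * δ sum + 2) * ((1 + δ clock) * (2 + δ clock)) := by
  simp [weight_up]

theorem eval_weight_down (δ : Place k → ℕ) :
    (MvPolynomial.eval δ (weight (down : NetRule k Q)) : ℝ) =
      (2 * (δ cap * δ tests) + 1) * ((1 + δ clock) * (2 + δ clock)) := by
  simp [weight_down, mul_assoc]

theorem eval_weight_exit (δ : Place k → ℕ) :
    (MvPolynomial.eval δ (weight (exit : NetRule k Q)) : ℝ) = 1 := by
  simp [weight_exit]

variable [Fintype Q]

open Classical in
/-- The rules of the net: from each control state of the program the net may give up; in the final
state `t` of the program it may start the random walk, which may be left at any time; after leaving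
either phase it removes all tokens. -/
def rules (E : Finset (Rule Q (Place k))) (t : Q) : Finset (NetRule k Q) :=
  E.image lift ∪ Finset.univ.image giveUp ∪ {halt t} ∪ {up, down, exit} ∪ Finset.univ.image remove

theorem mem_rules {E : Finset (Rule Q (Place k))} {t : Q} {r : NetRule k Q} :
    r ∈ rules E t ↔ (∃ r' ∈ E, lift r' = r) ∨ (∃ q, giveUp q = r) ∨ r = halt t ∨ r = up ∨
      r = down ∨ r = exit ∨ ∃ p, remove p = r := by
  simp only [rules, Finset.mem_union, Finset.mem_image, Finset.mem_insert, Finset.mem_singleton,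
    Finset.mem_univ, true_and, or_assoc]

variable [DecidableEq Q] {d : ℕ} (e : Ctl Q ⊕ Place k ≃ Fin d)
  (E : Finset (Rule Q (Place k))) (t : Q)

/-- The net that runs the program with the transitions `E` and the final control state `t`, and then
the random walk. -/
abbrev walkNet : PolyPPN d := net e (rules E t) weight fun r _ => weight_pos r

open Classical in
theorem enabledRules_walking (δ : Place k → ℕ) :
    enabledRules (rules E t) .walking δ = if δ walk = 0 then {exit} else {up, down, exit} := by
  ext r
  rw [mem_enabledRules, mem_rules]
  constructor
  · rintro ⟨⟨r, -, rfl⟩ | ⟨q, rfl⟩ | rfl | rfl | rfl | rfl | ⟨p, rfl⟩, h2, h3⟩ <;>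
      try simp [lift, giveUp, halt, remove] at h2
    · rw [if_neg (single_le_iff.1 h3)]; simp
    · rw [if_neg (single_le_iff.1 h3)]; simp
    · split_ifs <;> simp
  · split_ifs with h
    · intro h2
      rw [Finset.mem_singleton] at h2
      subst h2
      exact ⟨by simp, rfl, fun _ => Nat.zero_le _⟩
    · intro h2
      simp only [Finset.mem_insert, Finset.mem_singleton] at h2
      rcases h2 with rfl | rfl | rfl
      · exact ⟨by simp, rfl, single_le_iff.2 h⟩
      · exact ⟨by simp, rfl, single_le_iff.2 h⟩
      · exact ⟨by simp, rfl, fun _ => Nat.zero_le _⟩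

theorem exit_mem (δ : Place k → ℕ) : exit ∈ enabledRules (rules E t) .walking δ :=
  mem_enabledRules.2 ⟨mem_rules.2 (by simp), rfl, fun _ => Nat.zero_le _⟩

theorem giveUp_mem (q : Q) (δ : Place k → ℕ) :
    giveUp q ∈ enabledRules (rules E t) (.run q) δ :=
  mem_enabledRules.2 ⟨mem_rules.2 (by simp), rfl, fun _ => Nat.zero_le _⟩

theorem remove_mem {p : Place k} {δ : Place k → ℕ} (h : δ p ≠ 0) :
    remove p ∈ enabledRules (rules E t) .drain δ :=
  mem_enabledRules.2 ⟨mem_rules.2 (by simp), rfl, single_le_iff.2 h⟩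

/-- The target sets considered: they contain the marking in which all tokens are removed, and among
the markings with one control token they only contain markings with control `drain`. The singleton
of the former marking and its upward closure are both of this kind. -/
structure IsTarget (A : Set (Marking d)) : Prop where
  zero_mem : marking e .drain 0 ∈ A
  eq_drain : ∀ κ δ, marking e κ δ ∈ A → κ = .drain

variable {e} {A : Set (Marking d)}

/-- The markings outside `A` from which `A` is reachable. -/
def undecided (e : Ctl Q ⊕ Place k ≃ Fin d) (E : Finset (Rule Q (Place k))) (t : Q)
    (A : Set (Marking d)) : Set (Marking d) :=
  {m | m ∉ A ∧ (walkNet e E t).markovChain.CanReach m A}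

/-- In the control state `drain` the target is reachable. -/
theorem canReach_drain (hA : IsTarget e A) (δ : Place k → ℕ) :
    (walkNet e E t).markovChain.CanReach (marking e .drain δ) A := by
  induction hn : ∑ x, δ x using Nat.strong_induction_on generalizing δ with
  | _ n ih =>
    by_cases h0 : δ = 0
    · exact ⟨_, h0 ▸ hA.zero_mem, .refl⟩
    · obtain ⟨p, hp⟩ := Function.ne_iff.1 h0
      obtain ⟨m, hm, h⟩ := ih _ (hn ▸ sum_sub_single_lt hp) _ rfl
      have hr := mem_enabledRules.1 (remove_mem E t (Q := Q) hp)
      exact ⟨m, hm, .head (step_net e _ _ _ hr.1 hr.2.2) h⟩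

theorem mem_undecided_run (hA : IsTarget e A) (q : Q) (δ : Place k → ℕ) :
    marking e (.run q) δ ∈ undecided e E t A := by
  refine ⟨fun h => by simpa using hA.eq_drain _ _ h, ?_⟩
  obtain ⟨m, hm, h⟩ := canReach_drain E t hA (δ - 0 + 0)
  have hr := mem_enabledRules.1 (giveUp_mem E t q δ)
  exact ⟨m, hm, .head (step_net e _ _ _ hr.1 hr.2.2) h⟩

theorem mem_undecided_walking (hA : IsTarget e A) (δ : Place k → ℕ) :
    marking e .walking δ ∈ undecided e E t A := by
  refine ⟨fun h => by simpa using hA.eq_drain _ _ h, ?_⟩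
  obtain ⟨m, hm, h⟩ := canReach_drain E t hA (δ - 0 + 0)
  have hr := mem_enabledRules.1 (exit_mem E t δ)
  exact ⟨m, hm, .head (step_net e _ _ _ hr.1 hr.2.2) h⟩

/-- Removing tokens ends in the target. -/
theorem stay_drain (hA : IsTarget e A) (δ : Place k → ℕ) :
    (walkNet e E t).markovChain.stay (undecided e E t A) (marking e .drain δ) = 0 := by
  induction hn : ∑ x, δ x using Nat.strong_induction_on generalizing δ with
  | _ n ih =>
    by_cases hG : marking e .drain δ ∈ undecided e E t A
    swap
    · exact MarkovChain.stay_of_notMem _ hG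
    have h0 : δ ≠ 0 := fun h => hG.1 (h ▸ hA.zero_mem)
    obtain ⟨p, hp⟩ := Function.ne_iff.1 h0
    rw [MarkovChain.stay_of_mem _ hG, next_net e _ _ _ _ ⟨_, remove_mem E t hp⟩,
      Finset.sum_eq_zero, ENNReal.zero_div]
    intro r hr
    obtain ⟨hr, h1, h2⟩ := mem_enabledRules.1 hr
    rcases mem_rules.1 hr with ⟨r, -, rfl⟩ | ⟨q, rfl⟩ | rfl | rfl | rfl | rfl | ⟨p, rfl⟩ <;>
      try simp [lift, giveUp, halt, up, down, exit] at h1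
    have hp : δ p ≠ 0 := single_le_iff.1 h2
    have := ih _ (hn ▸ sum_sub_single_lt hp) _ rfl
    change _ * (walkNet e E t).markovChain.stay _ (marking e .drain (δ - Pi.single p 1 + 0)) = 0
    rw [this, mul_zero]

/-- A bound on a one-step expectation of the random walk, in terms of bounds `u`, `v` and `s` on
the values after `up`, `down` and `exit`. -/
theorem next_walking_le {F : Marking d → ENNReal} {δ : Place k → ℕ} {u v s B : ℝ}
    (hx : δ walk ≠ 0) (hu : 0 ≤ u) (hv : 0 ≤ v) (hs : 0 ≤ s)
    (hFu : F (marking e .walking (Function.update (Function.update δ walk (δ walk + 1))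
      clock (δ clock + 1))) ≤ ENNReal.ofReal u)
    (hFv : F (marking e .walking (Function.update (Function.update δ walk (δ walk - 1))
      clock (δ clock + 1))) ≤ ENNReal.ofReal v)
    (hFs : F (marking e .drain δ) ≤ ENNReal.ofReal s)
    (hB : (2 * δ sum + 2) * ((1 + δ clock) * (2 + δ clock)) * u +
      (2 * (δ cap * δ tests) + 1) * ((1 + δ clock) * (2 + δ clock)) * v + s ≤
      ((2 * δ sum + 2) * ((1 + δ clock) * (2 + δ clock)) +
      (2 * (δ cap * δ tests) + 1) * ((1 + δ clock) * (2 + δ clock)) + 1) * B) :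
    (walkNet e E t).markovChain.next F (marking e .walking δ) ≤ ENNReal.ofReal B := by
  classical
  have h1 : (up : NetRule k Q) ∉ ({down, exit} : Finset (NetRule k Q)) := by
    simp only [Finset.mem_insert, Finset.mem_singleton, not_or]
    exact ⟨up_ne_down, by simp [up, exit, Rule.ext_iff]⟩
  have h2 : (down : NetRule k Q) ∉ ({exit} : Finset (NetRule k Q)) := by
    simp [down, exit, Rule.ext_iff]
  have h3 := up_ne_down (k := k) (Q := Q)
  have h4 : (exit : NetRule k Q) ≠ up := by simp [up, exit, Rule.ext_iff]
  have h5 : (exit : NetRule k Q) ≠ down := by simp [down, exit, Rule.ext_iff]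
  have hen := enabledRules_walking E t δ
  rw [if_neg hx] at hen
  refine next_net_le e _ _ _ (v := fun r => if r = up then u else if r = down then v else s)
    ⟨_, exit_mem E t δ⟩ (fun r _ => by split_ifs <;> assumption) ?_ ?_
  · intro r hr
    rw [hen] at hr
    simp only [Finset.mem_insert, Finset.mem_singleton] at hr
    rcases hr with rfl | rfl | rfl
    · rw [up_data hx, if_pos rfl]; exact hFu
    · rw [down_data, if_neg h3.symm, if_pos rfl]; exact hFv
    · rw [if_neg h4, if_neg h5]; exact hFs
  · rw [hen]
    simp only [Finset.sum_insert h1, Finset.sum_insert h2, Finset.sum_singleton, eval_weight_up,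
      eval_weight_down, eval_weight_exit, if_true, h3.symm, h4, h5, if_false]
    linarith

/-- If the total number of tokens moved in zero tests is too small, the random walk drifts
downwards and therefore ends. -/
theorem stay_walking (hA : IsTarget e A) {δ : Place k → ℕ} (hδ : δ sum < δ cap * δ tests) :
    (walkNet e E t).markovChain.stay (undecided e E t A) (marking e .walking δ) = 0 := by
  classical
  let G : Set (Marking d) :=
    {m | ∃ δ : Place k → ℕ, marking e .walking δ = m ∧ δ sum < δ cap * δ tests}
  let val : Place k → Marking d → ℝ := fun p m => m (e (Sum.inr p))
  have hval : ∀ p κ δ, val p (marking e κ δ) = δ p := fun p κ δ => by simp [val, marking]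
  -- With `S = sum` and `z = cap * tests`, which do not change any more, the steps have weights
  -- proportional to `2 * S + 2` and `2 * z + 1`, where `S + 1 ≤ z`. A step lowers the position on
  -- average by at least `1 / (2 * S + 2 * z + 4)`, whence the factor in `V`.
  let V : Marking d → ENNReal := fun m => ENNReal.ofReal
    ((2 * val sum m + 2 * (val cap m * val tests m) + 4) * (val walk m + 1))
  have hnG : ∀ δ, marking e .drain δ ∉ G := by
    rintro δ ⟨δ', h, -⟩
    simpa using ((marking_inj e).1 h).1
  refine MarkovChain.eq_zero_of_foster (walkNet e E t).markovChain (G := G) (V := V)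
    (MarkovChain.stay_le_one _ _) ?_ ?_ (fun _ _ => ENNReal.ofReal_ne_top) ⟨δ, rfl, hδ⟩
  · rintro _ ⟨δ, rfl, hδ⟩
    refine (MarkovChain.stay_of_mem _ (mem_undecided_walking E t hA δ)).trans_le ?_
    refine next_net_mono e _ _ _ ⟨_, exit_mem E t δ⟩ fun r hr => ?_
    by_cases hm : marking e r.tgt (δ - r.pre + r.post) ∈ G
    · rw [Set.indicator_of_mem hm]
    · rw [Set.indicator_of_notMem hm]
      rw [enabledRules_walking] at hr
      have hr' : r = up ∨ r = down ∨ r = exit := by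
        split_ifs at hr
        · simp at hr; tauto
        · simpa using hr
      rcases hr' with rfl | rfl | rfl
      · exact absurd ⟨_, rfl, by simpa [up] using hδ⟩ hm
      · exact absurd ⟨_, rfl, by simpa [down] using hδ⟩ hm
      · exact (stay_drain E t hA _).le
  · rintro _ ⟨δ, rfl, hδ⟩
    have hab : (δ sum : ℝ) + 1 ≤ δ cap * δ tests := by exact_mod_cast hδ
    have hS : (0 : ℝ) ≤ δ sum := Nat.cast_nonneg _
    have hx0 : (0 : ℝ) ≤ δ walk := Nat.cast_nonneg _
    have hy0 : (0 : ℝ) ≤ δ clock := Nat.cast_nonneg _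
    have hB : 0 ≤ (2 * δ sum + 2 * (δ cap * δ tests) + 4 : ℝ) * (δ walk + 1) - 1 := by
      nlinarith
    suffices h : (walkNet e E t).markovChain.next (G.indicator V) (marking e .walking δ) ≤
        ENNReal.ofReal ((2 * δ sum + 2 * (δ cap * δ tests) + 4 : ℝ) * (δ walk + 1) - 1) by
      rw [show V (marking e .walking δ) = ENNReal.ofReal (1 +
          ((2 * δ sum + 2 * (δ cap * δ tests) + 4 : ℝ) * (δ walk + 1) - 1)) by
        simp only [V, hval, add_sub_cancel], ENNReal.ofReal_add zero_le_one hB, ENNReal.ofReal_one]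
      gcongr
    by_cases hx : δ walk = 0
    · have hen := enabledRules_walking E t δ
      rw [if_pos hx] at hen
      refine next_net_le e _ _ _ (v := fun _ => 0) ⟨_, exit_mem E t δ⟩ (fun _ _ => le_rfl) ?_ ?_
      · rw [hen]
        intro r hr
        rw [Finset.mem_singleton.1 hr, Set.indicator_of_notMem (by exact hnG _)]
        exact zero_le
      · simp only [mul_zero, Finset.sum_const_zero]
        exact mul_nonneg (Finset.sum_nonneg fun _ _ => Nat.cast_nonneg _) hB
    · have hle : ∀ m, G.indicator V m ≤ V m := fun m => Set.indicator_le_self' (by simp) m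
      have hx1 : ((δ walk - 1 : ℕ) : ℝ) = δ walk - 1 := by
        rw [Nat.cast_sub (Nat.one_le_iff_ne_zero.2 hx), Nat.cast_one]
      refine next_walking_le E t
        (u := (2 * δ sum + 2 * (δ cap * δ tests) + 4 : ℝ) * (δ walk + 2))
        (v := (2 * δ sum + 2 * (δ cap * δ tests) + 4 : ℝ) * δ walk) (s := 0)
        hx (by positivity) (by positivity) le_rfl ((hle _).trans ?_) ((hle _).trans ?_) ?_ ?_
      · simp only [V, hval]
        refine ENNReal.ofReal_le_ofReal (le_of_eq ?_)
        simp only [Function.update_apply, reduceCtorEq, if_true, if_false]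
        push_cast
        ring
      · simp only [V, hval]
        refine ENNReal.ofReal_le_ofReal (le_of_eq ?_)
        simp [hx1]
      · rw [Set.indicator_of_notMem (hnG _)]; exact zero_le
      · generalize (δ cap * δ tests : ℝ) = z at *
        generalize (δ sum : ℝ) = S at *
        generalize (δ walk : ℝ) = x at *
        have hg : (1 : ℝ) ≤ (1 + δ clock) * (2 + δ clock) := by nlinarith
        generalize ((1 + δ clock) * (2 + δ clock) : ℝ) = g at *
        have h1 : 0 ≤ (2 * S + 2 * z + 4) * x := by
          have : 0 ≤ z := by linarith
          positivity
        have h2 : 0 ≤ (2 * S + 2 * z + 4) * g * (2 * z - 2 * S - 2) := by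
          have : 0 ≤ z := by linarith
          refine mul_nonneg (by positivity) (by linarith)
        nlinarith

/-- If no run of the program reaches its final state with enough tokens moved in zero tests, the
path almost surely leaves the undecided markings. -/
theorem stay_run (hA : IsTarget e A) {q₀ : Q} {δ₀ : Place k → ℕ}
    (h : ∀ δ, Run (E : Set (Rule Q (Place k))) (q₀, δ₀) (t, δ) → δ sum < δ cap * δ tests) :
    (walkNet e E t).markovChain.stay (undecided e E t A) (marking e (.run q₀) δ₀) = 0 := by
  classical
  let G : Set (Marking d) := {m | ∃ q δ, marking e (.run q) δ = m ∧
    Run (E : Set (Rule Q (Place k))) (q₀, δ₀) (q, δ)}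
  -- While the program runs, all weights are `1`, so giving up has probability at least `1 / n`, and
  -- the constant `n` on `G` decreases by at least `1` on average.
  set n : ℝ := ((rules E t).card : ℝ) with hn
  have hnG : ∀ δ, marking e .drain δ ∉ G := by
    rintro δ ⟨q, δ', h, -⟩
    simpa using ((marking_inj e).1 h).1
  refine MarkovChain.eq_zero_of_foster (walkNet e E t).markovChain (G := G)
    (V := fun _ => ENNReal.ofReal n)
    (MarkovChain.stay_le_one _ _) ?_ ?_ (fun _ _ => ENNReal.ofReal_ne_top) ⟨q₀, δ₀, rfl, .refl⟩
  · rintro _ ⟨q, δ, rfl, hrun⟩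
    refine (MarkovChain.stay_of_mem _ (mem_undecided_run E t hA q δ)).trans_le ?_
    refine next_net_mono e _ _ _ ⟨_, giveUp_mem E t q δ⟩ fun r hr => ?_
    by_cases hm : marking e r.tgt (δ - r.pre + r.post) ∈ G
    · rw [Set.indicator_of_mem hm]
    · rw [Set.indicator_of_notMem hm]
      obtain ⟨hr, h1, h2⟩ := mem_enabledRules.1 hr
      rcases mem_rules.1 hr with ⟨r, hE, rfl⟩ | ⟨q, rfl⟩ | rfl | rfl | rfl | rfl | ⟨p, rfl⟩
      · have h1 : r.src = q := by simpa [lift] using h1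
        exact absurd ⟨_, _, rfl, hrun.tail ⟨r, hE, h1, h2, rfl, rfl⟩⟩ hm
      · exact (stay_drain E t hA _).le
      · have h1 : t = q := by simpa [halt] using h1
        subst h1
        exact (stay_walking E t hA (by simpa [halt] using h _ hrun)).le
      all_goals simp [up, down, exit, remove] at h1
  · rintro _ ⟨q, δ, rfl, -⟩
    have hg := giveUp_mem E t q δ
    set en := enabledRules (rules E t) (.run q) δ with hen
    have hcard : (en.card : ℝ) ≤ n := by
      rw [hn]; exact_mod_cast Finset.card_le_card (s := en) fun r hr => (mem_enabledRules.1 hr).1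
    have hpos : (1 : ℝ) ≤ en.card := by exact_mod_cast Finset.card_pos.2 ⟨_, hg⟩
    have hw : ∀ r ∈ en, (MvPolynomial.eval δ (weight r) : ℝ) = 1 := fun r hr => by
      rw [weight_run (mem_enabledRules.1 hr).2.1]; simp
    suffices h : (walkNet e E t).markovChain.next (G.indicator fun _ => ENNReal.ofReal n)
        (marking e (.run q) δ) ≤ ENNReal.ofReal (n - 1) by
      have h1 : ENNReal.ofReal n = 1 + ENNReal.ofReal (n - 1) := by
        rw [← ENNReal.ofReal_one, ← ENNReal.ofReal_add zero_le_one (by linarith), add_sub_cancel]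
      exact (add_le_add le_rfl h).trans h1.ge
    refine next_net_le e _ _ _ (v := fun r => if r = giveUp q then 0 else n) ⟨_, hg⟩
      (fun r _ => by split_ifs <;> linarith) ?_ ?_
    · intro r hr
      by_cases hrg : r = giveUp q
      · rw [hrg, Set.indicator_of_notMem (by exact hnG _)]; exact zero_le
      · rw [if_neg hrg]
        exact Set.indicator_le_self' (by simp) _
    · rw [← hen, Finset.sum_congr rfl hw, Finset.sum_congr rfl fun r hr => by rw [hw r hr],
        ← Finset.add_sum_erase _ _ hg]
      have h1 : ∑ r ∈ en.erase (giveUp q), (1 : ℝ) * (if r = giveUp q then 0 else n) =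
          (en.card - 1) * n := by
        rw [Finset.sum_congr rfl fun r hr => by rw [if_neg (Finset.ne_of_mem_erase hr)]]
        simp [Finset.card_erase_of_mem hg, Nat.cast_sub (Finset.card_pos.2 ⟨_, hg⟩)]
      rw [h1]
      simp
      nlinarith

/-- If all tokens were moved in zero tests, the random walk drifts upwards, and with positive
probability it goes on forever. -/
theorem stay_walking_pos (hA : IsTarget e A) {δ : Place k → ℕ} (hδ : δ sum = δ cap * δ tests)
    (hclock : δ clock = 0)
    (hwalk : ((2 * (δ cap * δ tests) + 1) / (2 * (δ cap * δ tests) + 2) : ℝ) ^ δ walk < 2 / 3) :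
    0 < (walkNet e E t).markovChain.stay (undecided e E t A) (marking e .walking δ) := by
  classical
  let val : Place k → Marking d → ℕ := fun p m => m (e (Sum.inr p))
  have hval : ∀ p κ δ, val p (marking e κ δ) = δ p := fun p κ δ => by simp [val, marking]
  let H : Set (Marking d) :=
    {m | ∃ δ : Place k → ℕ, marking e .walking δ = m ∧ δ sum = δ cap * δ tests}
  let G : Set (Marking d) := {m ∈ H | val walk m ≠ 0}
  -- With `b = 2 * cap * tests + 1` and `ρ = b / (b + 1)`, the upward and downward steps have
  -- weights proportional to `b + 1` and `b`, and `ρ ^ walk` is the probability that the walk, if it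
  -- is never left by `exit`, reaches zero. At time `y`, `exit` has probability at most
  -- `1 / (3 * (1 + y) * (2 + y))`, the decrease of `1 / (3 * (1 + y))` from `y` to `y + 1`. So `ψ`
  -- bounds the probability of reaching zero or leaving.
  let ψ : Marking d → ℝ := fun m =>
    ((2 * (val cap m * val tests m) + 1) / (2 * (val cap m * val tests m) + 2) : ℝ) ^ val walk m +
      1 / (3 * (1 + val clock m))
  let h : Marking d → ENNReal := fun m => if m ∈ H then ENNReal.ofReal (ψ m) else 1
  have hh : ∀ m ∈ G, (walkNet e E t).markovChain.next h m ≤ h m := by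
    rintro _ ⟨⟨δ, rfl, hδ⟩, hx⟩
    rw [hval] at hx
    have hmem : ∀ δ : Place k → ℕ, δ sum = δ cap * δ tests → marking e .walking δ ∈ H :=
      fun δ hδ => ⟨δ, rfl, hδ⟩
    simp only [h]
    rw [if_pos (hmem δ hδ)]
    set b : ℝ := 2 * (δ cap * δ tests) + 1 with hb
    have hb1 : 1 ≤ b := by
      have : (0 : ℝ) ≤ δ cap * δ tests := by positivity
      linarith
    have hb2 : (2 * (δ cap * δ tests) + 2 : ℝ) = b + 1 := by rw [hb]; ring
    obtain ⟨x, hx'⟩ := Nat.exists_eq_succ_of_ne_zero hx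
    refine next_walking_le E t (u := (b / (b + 1)) ^ (x + 2) + 1 / (3 * (2 + δ clock)))
      (v := (b / (b + 1)) ^ x + 1 / (3 * (2 + δ clock))) (s := 1)
      hx (by positivity) (by positivity) zero_le_one ?_ ?_ ?_ ?_
    · rw [if_pos (hmem _ (by simpa using hδ))]
      refine ENNReal.ofReal_le_ofReal (le_of_eq ?_)
      simp only [ψ, hval]
      simp [hx', hb2, ← hb]
      ring
    · rw [if_pos (hmem _ (by simpa using hδ))]
      refine ENNReal.ofReal_le_ofReal (le_of_eq ?_)
      simp only [ψ, hval]
      simp [hx', hb2, ← hb]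
      ring
    · rw [if_neg, ENNReal.ofReal_one]
      rintro ⟨δ', h, -⟩
      simpa using ((marking_inj e).1 h).1
    · have hS : (2 * δ sum + 2 : ℝ) = b + 1 := by rw [hδ, hb]; push_cast; ring
      simp only [ψ, hval]
      rw [hS, ← hb, hb2, hx']
      set ρ := b / (b + 1) with hρ
      have hρ1 : (b + 1) * ρ = b := by rw [hρ]; field_simp
      have hρ0 : 0 ≤ ρ := by positivity
      obtain ⟨y, hy⟩ : ∃ y : ℝ, y = δ clock := ⟨_, rfl⟩
      have hy0 : 0 ≤ y := hy ▸ Nat.cast_nonneg _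
      rw [← hy]
      have hp : 0 ≤ ρ ^ x := by positivity
      have e1 : (1 + y) * (2 + y) * (1 / (3 * (2 + y))) = (1 + y) / 3 := by field_simp
      have e2 : (1 + y) * (2 + y) * (1 / (3 * (1 + y))) = (2 + y) / 3 := by field_simp
      have hw : 0 ≤ 1 / (3 * (1 + y)) := by positivity
      have e3 : (b + 1) * ρ ^ (x + 2) + b * ρ ^ x = (2 * b + 1) * ρ ^ (x + 1) := by
        rw [pow_succ, pow_succ]
        linear_combination (ρ ^ x * ρ - ρ ^ x) * hρ1
      have e4 : 0 ≤ ρ ^ (x + 1) := by positivity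
      rw [Nat.succ_eq_add_one]
      generalize 1 / (3 * (1 + y)) = w1 at *
      generalize 1 / (3 * (2 + y)) = w2 at *
      generalize (1 + y) * (2 + y) = g at *
      have lhs : (b + 1) * g * (ρ ^ (x + 2) + w2) + b * g * (ρ ^ x + w2) + 1 =
          g * ((b + 1) * ρ ^ (x + 2) + b * ρ ^ x) + (2 * b + 1) * (g * w2) + 1 := by ring
      rw [lhs, e3, e1]
      have rhs : ((b + 1) * g + b * g + 1) * (ρ ^ (x + 1) + w1) =
          g * ((2 * b + 1) * ρ ^ (x + 1)) + (2 * b + 1) * (g * w1) + ρ ^ (x + 1) + w1 := by ring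
      rw [rhs, e2]
      nlinarith
  have hout : ∀ m ∉ G, 1 ≤ h m := by
    intro m hm
    simp only [h]
    split_ifs with hH
    · have h0 : val walk m = 0 := by
        by_contra h0
        exact hm ⟨hH, h0⟩
      rw [ENNReal.one_le_ofReal]
      simp only [ψ, h0, pow_zero]
      have : (0 : ℝ) ≤ 1 / (3 * (1 + val clock m)) := by positivity
      linarith
    · exact le_rfl
  have h1 := (walkNet e E t).markovChain.one_le_stay_add hh hout (marking e .walking δ)
  have h2 : h (marking e .walking δ) < 1 := by
    simp only [h]
    rw [if_pos ⟨δ, rfl, hδ⟩, ENNReal.ofReal_lt_one]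
    simp only [ψ, hval, hclock]
    norm_num
    linarith
  have hsub : G ⊆ undecided e E t A := by
    rintro _ ⟨⟨δ, rfl, -⟩, -⟩
    exact mem_undecided_walking E t hA δ
  refine lt_of_lt_of_le ?_ ((walkNet e E t).markovChain.stay_mono hsub _)
  refine pos_iff_ne_zero.2 fun h0 => ?_
  rw [h0, zero_add] at h1
  exact absurd h1 (not_le.2 h2)

/-- If some run of the program reaches its final state with all tokens moved in zero tests and the
random walk far from zero, the path stays in the undecided markings with positive probability. -/
theorem stay_run_pos (hA : IsTarget e A) {q₀ : Q} {δ₀ δ : Place k → ℕ}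
    (h : Run (E : Set (Rule Q (Place k))) (q₀, δ₀) (t, δ)) (hδ : δ sum = δ cap * δ tests)
    (hclock : δ clock = 0)
    (hwalk : ((2 * (δ cap * δ tests) + 1) / (2 * (δ cap * δ tests) + 2) : ℝ) ^ δ walk < 2 / 3) :
    0 < (walkNet e E t).markovChain.stay (undecided e E t A) (marking e (.run q₀) δ₀) := by
  have key : ∀ a b : Q × (Place k → ℕ), Run (E : Set (Rule Q (Place k))) a b → b = (t, δ) →
      0 < (walkNet e E t).markovChain.stay (undecided e E t A) (marking e (.run a.1) a.2) := by
    intro a b hab hb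
    induction hab using Relation.ReflTransGen.head_induction_on with
    | refl =>
      subst hb
      have h1 := step_net e (rules E t) weight (fun r _ => weight_pos r) (r := halt t)
        (mem_rules.2 (by simp)) (δ := δ) (fun _ => Nat.zero_le _)
      refine MarkovChain.stay_pos_of_step _ (mem_undecided_run E t hA _ _) h1 ?_
      exact stay_walking_pos E t hA (by simpa [halt] using hδ) (by simpa [halt] using hclock)
        (by simpa [halt] using hwalk)
    | head hac _ ih =>
      obtain ⟨r, hr, h1, h2, h3, h4⟩ := hac
      have h5 := step_net e (rules E t) weight (fun r _ => weight_pos r) (r := lift r)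
        (mem_rules.2 (.inl ⟨r, hr, rfl⟩)) h2
      refine MarkovChain.stay_pos_of_step _ (mem_undecided_run E t hA _ _)
        (t := marking e (lift r).tgt _) (by rw [← h1]; exact h5) ?_
      change 0 < (walkNet e E t).markovChain.stay _ (marking e (.run r.tgt) (_ - r.pre + r.post))
      rw [h3, ← h4]
      exact ih
  exact key _ _ h rfl

end WalkNet

/-! ### Counter programs and the relations they test -/

namespace RegularExpression

variable {α S : Type*}

/-- The relation denoted by a regular expression whose letters denote relations: a nondeterministic
program with choice, composition and iteration. -/
def rel (step : α → S → S → Prop) : RegularExpression α → S → S → Prop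
  | 0 => fun _ _ => False
  | 1 => Eq
  | char a => step a
  | P + Q => fun s s' => P.rel step s s' ∨ Q.rel step s s'
  | P * Q => Relation.Comp (P.rel step) (Q.rel step)
  | star P => Relation.ReflTransGen (P.rel step)

variable {step : α → S → S → Prop} {s s' : S} {P Q : RegularExpression α}

@[simp] theorem rel_zero : ¬ (0 : RegularExpression α).rel step s s' := id

@[simp] theorem rel_one : (1 : RegularExpression α).rel step s s' ↔ s = s' := Iff.rfl

@[simp] theorem rel_char {a : α} : (char a).rel step s s' ↔ step a s s' := Iff.rfl

@[simp] theorem rel_add : (P + Q).rel step s s' ↔ P.rel step s s' ∨ Q.rel step s s' := Iff.rfl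

@[simp] theorem rel_mul :
    (P * Q).rel step s s' ↔ ∃ u, P.rel step s u ∧ Q.rel step u s' := Iff.rfl

theorem rel_star : P.star.rel step s s' ↔ Relation.ReflTransGen (P.rel step) s s' := Iff.rfl

end RegularExpression

/-- The iterates of a relation that is deterministic, but may block, along an orbit `st`. -/
theorem Relation.reflTransGen_iff_of_iterate {S : Type*} {R : S → S → Prop} {st : ℕ → S}
    {p : ℕ → Prop} (h : ∀ t s', R (st t) s' ↔ p t ∧ s' = st (t + 1)) {s' : S} :
    Relation.ReflTransGen R (st 0) s' ↔ ∃ n, (∀ t < n, p t) ∧ s' = st n := by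
  constructor
  · intro hr
    induction hr with
    | refl => exact ⟨0, by simp, rfl⟩
    | tail _ h1 ih =>
      obtain ⟨n, hn, rfl⟩ := ih
      obtain ⟨h2, rfl⟩ := (h _ _).1 h1
      refine ⟨n + 1, fun t ht => ?_, rfl⟩
      rcases Nat.lt_succ_iff_lt_or_eq.1 ht with h3 | rfl
      exacts [hn t h3, h2]
  · rintro ⟨n, hn, rfl⟩
    induction n with
    | zero => exact .refl
    | succ n ih =>
      exact (ih fun t ht => hn t (ht.trans n.lt_succ_self)).tail
        ((h _ _).2 ⟨hn n n.lt_succ_self, rfl⟩)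

/-- The instructions of a program with counters, which are numbered by the natural numbers. -/
inductive Instr
  | inc (i : ℕ)
  | dec (i : ℕ)
  | isZero (i : ℕ)

namespace Instr

/-- The effect of an instruction on the values of the counters; `dec` and `isZero` may block. -/
def step : Instr → (ℕ → ℕ) → (ℕ → ℕ) → Prop
  | inc i, s, s' => s' = Function.update s i (s i + 1)
  | dec i, s, s' => s i ≠ 0 ∧ s' = Function.update s i (s i - 1)
  | isZero i, s, s' => s i = 0 ∧ s' = s

end Instr

/-- A nondeterministic program with counters, in the form of a regular expression. This control
structure suffices, since programs are only used to test relations, by guessing witnesses. -/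
abbrev Prog := RegularExpression Instr

namespace Prog

open RegularExpression Instr Function

/-- The input-output relation of a program. -/
abbrev Exec (P : Prog) : (ℕ → ℕ) → (ℕ → ℕ) → Prop := P.rel Instr.step

/-- The program that adds any number to the counter `r`. -/
def guess (r : ℕ) : Prog := star (char (inc r))

/-- The program that sets the counter `r` to zero. -/
def clear (r : ℕ) : Prog := star (char (dec r)) * char (isZero r)

theorem exec_guess {r : ℕ} {s s' : ℕ → ℕ} (h : s r = 0) :
    Exec (guess r) s s' ↔ ∃ v, s' = update s r v := by
  have h1 := Relation.reflTransGen_iff_of_iterate (R := (char (inc r)).rel Instr.step)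
    (st := fun t => update s r t) (p := fun _ => True) (s' := s') (fun t u => by
      simp [Instr.step])
  rw [show update s r 0 = s by rw [← h, update_eq_self]] at h1
  rw [Exec, guess, rel_star, h1]
  simp

theorem exec_clear {r : ℕ} {s s' : ℕ → ℕ} : Exec (clear r) s s' ↔ s' = update s r 0 := by
  have h1 : ∀ s', _ ↔ _ := fun s' =>
    Relation.reflTransGen_iff_of_iterate (R := (char (dec r)).rel Instr.step)
    (st := fun t => update s r (s r - t)) (p := fun t => t < s r) (s' := s') (fun t u => by
      simp [Instr.step, Nat.sub_sub, Nat.sub_eq_zero_iff_le])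
  simp only [Nat.sub_zero, update_eq_self] at h1
  rw [Exec, clear, rel_mul]
  simp only [rel_star, h1, rel_char, Instr.step]
  constructor
  · rintro ⟨u, ⟨n, -, rfl⟩, h2, rfl⟩
    rw [update_self] at h2
    rw [h2]
  · rintro rfl
    exact ⟨_, ⟨s r, by simp, rfl⟩, by simp, by simp⟩

/-- `φ` can be tested with scratch counters `b, b + 1, …`: there is a program which, started with
these counters zero, can terminate if and only if `φ` holds, and then changes nothing. -/
def IsTest (b : ℕ) (φ : (ℕ → ℕ) → Prop) : Prop :=
  ∃ P : Prog, ∀ s, (∀ i, b ≤ i → s i = 0) → ∀ s', Exec P s s' ↔ s' = s ∧ φ s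

variable {b : ℕ} {φ ψ : (ℕ → ℕ) → Prop}

theorem IsTest.congr (h : IsTest b φ) (hφ : ∀ s, φ s ↔ ψ s) : IsTest b ψ := by
  rwa [← show φ = ψ from funext fun s => propext (hφ s)]

theorem isTest_zero (x : ℕ) : IsTest b fun s => s x = 0 :=
  ⟨char (isZero x), fun s _ s' => by simp [Instr.step, and_comm]⟩

theorem IsTest.and (h : IsTest b φ) (h' : IsTest b ψ) : IsTest b fun s => φ s ∧ ψ s := by
  obtain ⟨P, hP⟩ := h
  obtain ⟨Q, hQ⟩ := h'
  refine ⟨P * Q, fun s hs s' => ?_⟩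
  simp only [rel_mul, hP s hs]
  constructor
  · rintro ⟨u, ⟨rfl, h1⟩, h2⟩
    have h3 := (hQ _ hs _).1 h2
    exact ⟨h3.1, h1, h3.2⟩
  · rintro ⟨rfl, h1, h2⟩
    exact ⟨_, ⟨rfl, h1⟩, (hQ _ hs _).2 ⟨rfl, h2⟩⟩

theorem IsTest.or (h : IsTest b φ) (h' : IsTest b ψ) : IsTest b fun s => φ s ∨ ψ s := by
  obtain ⟨P, hP⟩ := h
  obtain ⟨Q, hQ⟩ := h'
  refine ⟨P + Q, fun s hs s' => ?_⟩
  simp only [rel_add, hP s hs, hQ s hs]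
  tauto

/-- An existential quantifier is tested by guessing a witness in the first scratch counter. -/
theorem IsTest.exists {χ : (ℕ → ℕ) → ℕ → Prop} (h : IsTest (b + 1) φ)
    (hφ : ∀ s v, φ (update s b v) ↔ χ s v) : IsTest b fun s => ∃ v, χ s v := by
  obtain ⟨P, hP⟩ := h
  refine ⟨guess b * (P * clear b), fun s hs s' => ?_⟩
  have h1 : ∀ v i, b + 1 ≤ i → update s b v i = 0 := fun v i hi => by
    rw [update_of_ne (by omega), hs i (by omega)]
  have h2 : update s b 0 = s := by rw [← hs b le_rfl, update_eq_self]
  simp only [rel_mul, exec_guess (hs b le_rfl), exec_clear]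
  constructor
  · rintro ⟨_, ⟨v, rfl⟩, u, h3, rfl⟩
    obtain ⟨rfl, h4⟩ := (hP _ (h1 v) _).1 h3
    rw [update_idem, h2]
    exact ⟨rfl, v, (hφ s v).1 h4⟩
  · rintro ⟨rfl, v, h3⟩
    exact ⟨_, ⟨v, rfl⟩, _, (hP _ (h1 v) _).2 ⟨rfl, (hφ _ v).2 h3⟩, by rw [update_idem, h2]⟩

theorem isTest_eq {x y : ℕ} (hx : x < b) (hy : y < b) : IsTest b fun s => s x = s y := by
  by_cases hxy : x = y
  · exact ⟨1, fun s _ s' => by simp [hxy, eq_comm]⟩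
  -- Both counters are decremented to zero and restored from a copy.
  refine ⟨star (char (dec x) * (char (dec y) * char (inc b))) * (char (isZero x) *
    (char (isZero y) * (star (char (dec b) * (char (inc x) * char (inc y))) *
    char (isZero b)))), fun s hs s' => ?_⟩
  have hb := hs b le_rfl
  let st : ℕ → ℕ → ℕ := fun t =>
    update (update (update s x (s x - t)) y (s y - t)) b t
  have st0 : st 0 = s := by
    simp only [st, Nat.sub_zero, update_eq_self]
    rw [← hb, update_eq_self]
  have hxb : x ≠ b := hx.ne
  have hyb : y ≠ b := hy.ne
  have stx : ∀ t, st t x = s x - t := fun t => by simp [st, hxb, hxy]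
  have sty : ∀ t, st t y = s y - t := fun t => by simp [st, hyb]
  have stb : ∀ t, st t b = t := fun t => by simp [st]
  have down : ∀ t, update (update (update (st t) x (s x - t - 1)) y (s y - t - 1)) b (t + 1) =
      st (t + 1) := fun t => by
    funext i
    simp only [st, update_apply]
    split_ifs <;> omega
  have up : ∀ t, t < s x → t < s y → update (update (update (st (t + 1)) b t) x (s x - t)) y
      (s y - t) = st t := fun t h1 h2 => by
    funext i
    simp only [st, update_apply]
    split_ifs <;> omega
  have l1 : ∀ u, _ ↔ _ := fun u => Relation.reflTransGen_iff_of_iterate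
    (R := (char (dec x) * (char (dec y) * char (inc b))).rel Instr.step)
    (st := st) (p := fun t => t < s x ∧ t < s y) (s' := u) (fun t u => by
      simp only [rel_mul, rel_char, Instr.step, stx]
      constructor
      · rintro ⟨_, ⟨h1, rfl⟩, _, ⟨h2, rfl⟩, rfl⟩
        simp [Ne.symm hxy, sty] at h2
        refine ⟨⟨by omega, by omega⟩, ?_⟩
        rw [← down]
        simp [Ne.symm hxy, hxb.symm, hyb.symm, sty, stb]
      · rintro ⟨⟨h1, h2⟩, rfl⟩
        refine ⟨_, ⟨by omega, rfl⟩, _, ⟨?_, rfl⟩, ?_⟩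
        · simp [Ne.symm hxy, sty]; omega
        · rw [← down]
          simp [Ne.symm hxy, hxb.symm, hyb.symm, sty, stb])
  have l2 : ∀ n, n ≤ s x → n ≤ s y → ∀ u, _ ↔ _ := fun n hnx hny u =>
    Relation.reflTransGen_iff_of_iterate
    (R := (char (dec b) * (char (inc x) * char (inc y))).rel Instr.step)
    (st := fun t => st (n - t)) (p := fun t => t < n) (s' := u) (fun t u => by
      have key : t < n → update (update (update (st (n - t)) b (st (n - t) b - 1)) x
          (update (st (n - t)) b (st (n - t) b - 1) x + 1)) y
          (update (update (st (n - t)) b (st (n - t) b - 1)) x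
          (update (st (n - t)) b (st (n - t) b - 1) x + 1) y + 1) = st (n - (t + 1)) := by
        intro ht
        rw [← up (n - (t + 1)) (by omega) (by omega), show n - (t + 1) + 1 = n - t by omega]
        simp only [stb, update_of_ne hxb, stx, update_of_ne (Ne.symm hxy), update_of_ne hyb, sty]
        rw [show n - t - 1 = n - (t + 1) by omega,
          show s x - (n - t) + 1 = s x - (n - (t + 1)) by omega,
          show s y - (n - t) + 1 = s y - (n - (t + 1)) by omega]
      simp only [rel_mul, rel_char, Instr.step]
      constructor
      · rintro ⟨_, ⟨h1, rfl⟩, _, rfl, rfl⟩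
        rw [stb] at h1
        exact ⟨by omega, key (by omega)⟩
      · rintro ⟨h1, rfl⟩
        exact ⟨_, ⟨by rw [stb]; omega, rfl⟩, _, rfl, (key h1).symm⟩)
  rw [st0] at l1
  simp only [rel_mul, rel_star, l1, rel_char, Instr.step]
  constructor
  · rintro ⟨_, ⟨n, hn, rfl⟩, _, ⟨h1, rfl⟩, _, ⟨h2, rfl⟩, u, h3, h4, rfl⟩
    rw [stx] at h1
    rw [sty] at h2
    have hnx : n ≤ s x := by
      by_contra h
      exact absurd (hn (s x) (by omega)).1 (lt_irrefl _)
    have hny : n ≤ s y := by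
      by_contra h
      exact absurd (hn (s y) (by omega)).2 (lt_irrefl _)
    have h5 := (l2 n hnx hny s').1 (by simpa using h3)
    obtain ⟨m, hm, rfl⟩ := h5
    rw [stb] at h4
    rw [h4, st0]
    exact ⟨rfl, by omega⟩
  · rintro ⟨rfl, h⟩
    refine ⟨_, ⟨s' x, fun t ht => ⟨ht, h ▸ ht⟩, rfl⟩, _, ⟨by rw [stx]; omega, rfl⟩, _,
      ⟨by rw [sty]; omega, rfl⟩, s', ?_, hb, rfl⟩
    have := (l2 (s' x) le_rfl h.le s').2 ⟨s' x, fun _ => id, by simp [st0]⟩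
    simpa using this

theorem isTest_succ {x y : ℕ} (hx : x < b) (hy : y < b) : IsTest b fun s => s y = s x + 1 := by
  by_cases hxy : x = y
  · exact ⟨0, fun s _ s' => by simp [hxy]⟩
  obtain ⟨P, hP⟩ := isTest_eq (b := b) hx hy
  beta_reduce at hP
  refine ⟨char (dec y) * (P * char (inc y)), fun s hs s' => ?_⟩
  have h1 : ∀ i, b ≤ i → update s y (s y - 1) i = 0 := fun i hi => by
    rw [update_of_ne (by omega), hs i hi]
  simp only [rel_mul, rel_char, Instr.step]
  constructor
  · rintro ⟨_, ⟨h2, rfl⟩, u, h3, rfl⟩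
    obtain ⟨rfl, h4⟩ := (hP _ h1 _).1 h3
    rw [update_of_ne hxy, update_self] at h4
    rw [update_idem, update_self, Nat.sub_add_cancel (by omega), update_eq_self]
    exact ⟨rfl, by omega⟩
  · rintro ⟨rfl, h2⟩
    refine ⟨_, ⟨by omega, rfl⟩, _, (hP _ h1 _).2 ⟨rfl, ?_⟩, ?_⟩
    · rw [update_of_ne hxy, update_self]; omega
    · rw [update_idem, update_self, Nat.sub_add_cancel (by omega), update_eq_self]

/-- Iterating a testable relation `ψ` between consecutive terms of a sequence: the existence of a
sequence from `s a` to `s y` of length `s n` is testable. The loop keeps the index in the counter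
`b`, the current term in `b + 1` and the next term in `b + 2`. -/
theorem isTest_iterate {ψ : (ℕ → ℕ) → ℕ → ℕ → ℕ → Prop} {a n y : ℕ}
    (h : IsTest (b + 3) fun s => ψ s (s b) (s (b + 1)) (s (b + 2)))
    (hψ : ∀ s s' : ℕ → ℕ, (∀ i < b, s i = s' i) → ψ s = ψ s') (ha : a < b) (hn : n < b)
    (hy : y < b) :
    IsTest b fun s => ∃ r : ℕ → ℕ, r 0 = s a ∧ (∀ i < s n, ψ s i (r i) (r (i + 1))) ∧
      r (s n) = s y := by
  obtain ⟨P, hP⟩ := h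
  obtain ⟨A, hA⟩ := isTest_eq (b := b + 3) (x := b + 1) (y := a) (by omega) (by omega)
  obtain ⟨B, hB⟩ := isTest_eq (b := b + 3) (x := b + 1) (y := b + 2) (by omega) (by omega)
  obtain ⟨N, hN⟩ := isTest_eq (b := b + 3) (x := b) (y := n) (by omega) (by omega)
  obtain ⟨Y, hY⟩ := isTest_eq (b := b + 3) (x := b + 1) (y := y) (by omega) (by omega)
  beta_reduce at hP hA hB hN hY
  let body : Prog := guess (b + 2) * (P * (clear (b + 1) * (guess (b + 1) * (B *
    (clear (b + 2) * char (inc b))))))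
  refine ⟨guess (b + 1) * (A * (star body * (N * (Y * (clear b * clear (b + 1)))))),
    fun s hs s' => ?_⟩
  let st : ℕ → ℕ → ℕ → ℕ → ℕ := fun i u v j =>
    if j = b then i else if j = b + 1 then u else if j = b + 2 then v else s j
  have u0 : ∀ i u v w, update (st i u v) b w = st w u v := fun i u v w => by
    funext j; simp only [st, update_apply]; split_ifs <;> omega
  have u1 : ∀ i u v w, update (st i u v) (b + 1) w = st i w v := fun i u v w => by
    funext j; simp only [st, update_apply]; split_ifs <;> omega
  have u2 : ∀ i u v w, update (st i u v) (b + 2) w = st i u w := fun i u v w => by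
    funext j; simp only [st, update_apply]; split_ifs <;> omega
  have v0 : ∀ i u v, st i u v b = i := fun i u v => by simp [st]
  have v1 : ∀ i u v, st i u v (b + 1) = u := fun i u v => by simp [st]
  have v2 : ∀ i u v, st i u v (b + 2) = v := fun i u v => by simp [st]
  have vlt : ∀ i u v j, j < b → st i u v j = s j := fun i u v j hj => by
    simp only [st]; rw [if_neg (by omega), if_neg (by omega), if_neg (by omega)]
  have vge : ∀ i u v j, b + 3 ≤ j → st i u v j = 0 := fun i u v j hj => by
    simp only [st]; rw [if_neg (by omega), if_neg (by omega), if_neg (by omega)]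
    exact hs j (by omega)
  have st0 : st 0 0 0 = s := by
    funext j
    simp only [st]
    split_ifs with h1 h2 h3
    · rw [h1, hs b le_rfl]
    · rw [h2, hs _ (by omega)]
    · rw [h3, hs _ (by omega)]
    · rfl
  have hψs : ∀ i u v, ψ (st i u v) = ψ s := fun i u v => hψ _ _ (vlt i u v)
  have hbody : ∀ i u s', Exec body (st i u 0) s' ↔ ∃ v, ψ s i u v ∧ s' = st (i + 1) v 0 := by
    intro i u s'
    simp only [body, rel_mul, exec_guess (v2 i u 0), exec_clear, rel_char, Instr.step, u2]
    constructor
    · rintro ⟨_, ⟨v, rfl⟩, _, h1, _, rfl, _, h2, _, h3, _, rfl, rfl⟩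
      obtain ⟨rfl, h4⟩ := (hP _ (vge _ _ _) _).1 h1
      rw [u1] at h2
      obtain ⟨w, rfl⟩ := (exec_guess (v1 _ _ _)).1 h2
      rw [u1] at h3
      obtain ⟨rfl, h5⟩ := (hB _ (vge _ _ _) _).1 h3
      rw [v1, v2] at h5
      rw [hψs, v0, v1, v2] at h4
      exact ⟨v, h4, by rw [u2, u0, v0, h5]⟩
    · rintro ⟨v, h1, rfl⟩
      refine ⟨_, ⟨v, rfl⟩, _, (hP _ (vge _ _ _) _).2 ⟨rfl, ?_⟩, _, rfl, st i v v, ?_, _,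
        (hB _ (vge _ _ _) _).2 ⟨rfl, ?_⟩, _, rfl, ?_⟩
      · rwa [hψs, v0, v1, v2]
      · rw [u1]
        exact (exec_guess (v1 _ _ _)).2 ⟨v, by rw [u1]⟩
      · rw [v1, v2]
      · rw [u2, u0, v0]
  have hloop : ∀ u s', Relation.ReflTransGen (Exec body) (st 0 u 0) s' ↔
      ∃ (m : ℕ) (r : ℕ → ℕ), r 0 = u ∧ (∀ i < m, ψ s i (r i) (r (i + 1))) ∧
        s' = st m (r m) 0 := by
    intro u s'
    constructor
    · intro hr
      induction hr with
      | refl => exact ⟨0, fun _ => u, rfl, by simp, rfl⟩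
      | tail _ h1 ih =>
        obtain ⟨m, r, h2, h3, rfl⟩ := ih
        obtain ⟨v, h4, rfl⟩ := (hbody _ _ _).1 h1
        refine ⟨m + 1, update r (m + 1) v, by simpa using h2, fun i hi => ?_, by simp⟩
        rw [update_of_ne (by omega)]
        rcases Nat.lt_succ_iff_lt_or_eq.1 hi with h5 | rfl
        · rw [update_of_ne (by omega)]; exact h3 i h5
        · rwa [update_self]
    · rintro ⟨m, r, rfl, h3, rfl⟩
      induction m with
      | zero => exact .refl
      | succ m ih =>
        exact (ih fun i hi => h3 i (by omega)).tail
          ((hbody _ _ _).2 ⟨_, h3 m (by omega), rfl⟩)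
  have hs1 : s (b + 1) = 0 := hs _ (by omega)
  simp only [rel_mul, exec_guess hs1, exec_clear, rel_star]
  constructor
  · rintro ⟨_, ⟨u, rfl⟩, _, h1, _, h2, _, h3, _, h4, _, rfl, rfl⟩
    rw [← st0, u1] at h1
    obtain ⟨rfl, h5⟩ := (hA _ (vge _ _ _) _).1 h1
    rw [v1, vlt _ _ _ _ ha] at h5
    obtain ⟨m, r, hr0, hr, rfl⟩ := (hloop _ _).1 h2
    obtain ⟨rfl, h6⟩ := (hN _ (vge _ _ _) _).1 h3
    obtain ⟨rfl, h7⟩ := (hY _ (vge _ _ _) _).1 h4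
    rw [v0, vlt _ _ _ _ hn] at h6
    rw [v1, vlt _ _ _ _ hy] at h7
    subst h6
    rw [u0, u1, st0]
    exact ⟨rfl, r, hr0.trans h5, hr, h7⟩
  · rintro ⟨rfl, r, h1, h2, h3⟩
    refine ⟨_, ⟨s' a, rfl⟩, st 0 (s' a) 0, ?_, st (s' n) (s' y) 0, ?_, _,
      (hN _ (vge _ _ _) _).2 ⟨rfl, ?_⟩, _, (hY _ (vge _ _ _) _).2 ⟨rfl, ?_⟩, _, rfl, ?_⟩
    · nth_rw 1 [← st0]
      rw [u1]
      exact (hA _ (vge _ _ _) _).2 ⟨rfl, by rw [v1, vlt _ _ _ _ ha]⟩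
    · exact (hloop _ _).2 ⟨s' n, r, h1, h2, by rw [h3]⟩
    · rw [v0, vlt _ _ _ _ hn]
    · rw [v1, vlt _ _ _ _ hy]
    · rw [u0, u1, st0]

end Prog

/-! ### Programs for the graphs of partial recursive functions -/

namespace Prog
open RegularExpression Instr Function

variable {b : ℕ}

theorem isTest_add {x y z : ℕ} (hx : x < b) (hy : y < b) (hz : z < b) :
    IsTest b fun s => s z = s x + s y := by
  refine (isTest_iterate (ψ := fun _ _ u v => v = u + 1) (b := b) (a := x) (n := y) (y := z)
    (isTest_succ (by omega) (by omega)) (fun _ _ _ => rfl) hx hy hz).congr fun s => ?_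
  constructor
  · rintro ⟨r, h0, h1, h2⟩
    have h3 : ∀ i ≤ s y, r i = s x + i := by
      intro i hi
      induction i with
      | zero => simpa using h0
      | succ i ih => rw [h1 i hi, ih (by omega), add_assoc]
    rw [← h2, h3 _ le_rfl]
  · intro h
    exact ⟨fun i => s x + i, rfl, fun i _ => rfl, h.symm⟩

theorem isTest_mul {x y z : ℕ} (hx : x < b) (hy : y < b) (hz : z < b) :
    IsTest b fun s => s z = s x * s y := by
  have h1 : IsTest (b + 1) fun s => s b = 0 ∧ ∃ r : ℕ → ℕ, r 0 = s b ∧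
      (∀ i < s y, r (i + 1) = r i + s x) ∧ r (s y) = s z :=
    (isTest_zero b).and (isTest_iterate (ψ := fun s _ u v => v = u + s x)
      (isTest_add (by omega) (by omega) (by omega))
      (fun s s' h => by simp only [h x (by omega)]) (by omega) (by omega) (by omega))
  refine (IsTest.exists (χ := fun s v => v = 0 ∧ ∃ r : ℕ → ℕ, r 0 = v ∧
      (∀ i < s y, r (i + 1) = r i + s x) ∧ r (s y) = s z) h1
    (fun s v => by simp [hx.ne, hy.ne, hz.ne])).congr fun s => ?_
  constructor
  · rintro ⟨_, rfl, r, h0, h1, h2⟩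
    have h3 : ∀ i ≤ s y, r i = s x * i := by
      intro i hi
      induction i with
      | zero => simpa using h0
      | succ i ih => rw [h1 i hi, ih (by omega), mul_add_one]
    rw [← h2, h3 _ le_rfl]
  · intro h
    exact ⟨0, rfl, fun i => s x * i, by simp, fun i _ => mul_add_one _ _, h.symm⟩

theorem isTest_le {x y : ℕ} (hx : x < b) (hy : y < b) : IsTest b fun s => s x ≤ s y := by
  refine (IsTest.exists (χ := fun s v => s y = s x + v)
    (isTest_add (x := x) (y := b) (z := y) (by omega) (by omega) (by omega))
    (fun s v => by simp [hx.ne, hy.ne])).congr fun s => le_iff_exists_add.symm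

theorem isTest_lt {x y : ℕ} (hx : x < b) (hy : y < b) : IsTest b fun s => s x < s y := by
  refine (IsTest.exists (χ := fun s v => v = s x + 1 ∧ v ≤ s y)
    ((isTest_succ (x := x) (y := b) (by omega) (by omega)).and
      (isTest_le (x := b) (y := y) (by omega) (by omega)))
    (fun s v => by simp [hx.ne, hy.ne])).congr fun s => by simp

theorem isTest_pair {x y z : ℕ} (hx : x < b) (hy : y < b) (hz : z < b) :
    IsTest b fun s => s z = Nat.pair (s x) (s y) := by
  have h1 : IsTest b fun s => s x < s y ∧ ∃ v, v = s y * s y ∧ s z = v + s x :=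
    (isTest_lt hx hy).and (IsTest.exists (χ := fun s v => v = s y * s y ∧ s z = v + s x)
      ((isTest_mul (x := y) (y := y) (z := b) (by omega) (by omega) (by omega)).and
        (isTest_add (x := b) (y := x) (z := z) (by omega) (by omega) (by omega)))
      (fun s v => by simp [hx.ne, hy.ne, hz.ne]))
  have h2 : IsTest b fun s => s y ≤ s x ∧ ∃ v, v = s x * s x ∧ ∃ w, w = v + s x ∧ s z = w + s y :=
    (isTest_le hy hx).and (IsTest.exists
      (χ := fun s v => v = s x * s x ∧ ∃ w, w = v + s x ∧ s z = w + s y)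
      ((isTest_mul (x := x) (y := x) (z := b) (by omega) (by omega) (by omega)).and
        (IsTest.exists (χ := fun s w => w = s b + s x ∧ s z = w + s y)
          ((isTest_add (x := b) (y := x) (z := b + 1) (by omega) (by omega) (by omega)).and
            (isTest_add (x := b + 1) (y := y) (z := z) (by omega) (by omega) (by omega)))
          (fun s v => by
            simp [show x ≠ b + 1 by omega, show y ≠ b + 1 by omega, show z ≠ b + 1 by omega])))
      (fun s v => by simp [hx.ne, hy.ne, hz.ne]))
  refine (h1.or h2).congr fun s => ?_
  rw [Nat.pair]
  split_ifs with h <;> simp [h]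
  omega

/-- The graph of the partial function `f` can be tested, for any counters `x` and `y` that hold the
argument and the value. -/
def IsGraph (f : ℕ →. ℕ) : Prop :=
  ∀ b x y, x < b → y < b → IsTest b fun s => s y ∈ f (s x)

/-- The values of a primitive recursion are the ends of its computation sequences. -/
theorem mem_rec_iff (f : ℕ →. ℕ) (g : ℕ → ℕ → Part ℕ) (a n y : ℕ) :
    y ∈ (Nat.rec (f a) (fun i IH => IH >>= fun u => g i u) n : Part ℕ) ↔
      ∃ r₀, r₀ ∈ f a ∧ ∃ r : ℕ → ℕ, r 0 = r₀ ∧ (∀ i < n, r (i + 1) ∈ g i (r i)) ∧ r n = y := by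
  induction n generalizing y with
  | zero =>
    constructor
    · intro h
      exact ⟨y, h, fun _ => y, rfl, by simp, rfl⟩
    · rintro ⟨_, h, r, rfl, -, rfl⟩
      exact h
  | succ n ih =>
    simp only [Part.bind_eq_bind, Part.mem_bind_iff] at ih ⊢
    constructor
    · rintro ⟨u, hu, hy⟩
      obtain ⟨r₀, h0, r, hr0, hr, rfl⟩ := (ih u).1 hu
      refine ⟨r₀, h0, update r (n + 1) y, by simpa using hr0, fun i hi => ?_, by simp⟩
      rw [update_of_ne (by omega : i ≠ n + 1)]
      rcases Nat.lt_succ_iff_lt_or_eq.1 hi with h5 | rfl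
      · rw [update_of_ne (by omega)]; exact hr i h5
      · rwa [update_self]
    · rintro ⟨r₀, h0, r, hr0, hr, rfl⟩
      exact ⟨r n, (ih _).2 ⟨r₀, h0, r, hr0, fun i hi => hr i (by omega), rfl⟩, hr n (by omega)⟩

theorem IsGraph.comp {f g : ℕ →. ℕ} (hf : IsGraph f) (hg : IsGraph g) :
    IsGraph fun n => g n >>= f := fun b x y hx hy =>
  (IsTest.exists (χ := fun s v => v ∈ g (s x) ∧ s y ∈ f v)
    ((hg (b + 1) x b (by omega) (by omega)).and (hf (b + 1) b y (by omega) (by omega)))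
    (fun s v => by simp [hx.ne, hy.ne])).congr fun s => Part.mem_bind_iff.symm

theorem IsGraph.pair {f g : ℕ →. ℕ} (hf : IsGraph f) (hg : IsGraph g) :
    IsGraph fun n => Nat.pair <$> f n <*> g n := fun b x y hx hy =>
  (IsTest.exists (χ := fun s v => v ∈ f (s x) ∧ ∃ w, w ∈ g (s x) ∧ s y = Nat.pair v w)
    ((hf (b + 1) x b (by omega) (by omega)).and
      (IsTest.exists (χ := fun s w => w ∈ g (s x) ∧ s y = Nat.pair (s b) w)
        ((hg (b + 2) x (b + 1) (by omega) (by omega)).and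
          (isTest_pair (x := b) (y := b + 1) (z := y) (by omega) (by omega) (by omega)))
        (fun s w => by simp [show x ≠ b + 1 by omega, show y ≠ b + 1 by omega])))
    (fun s v => by simp [hx.ne, hy.ne])).congr fun s => by
      simp only [Seq.seq, Part.mem_bind_iff, Part.map_eq_map, Part.mem_map_iff]
      constructor
      · rintro ⟨v, hv, w, hw, h⟩
        exact ⟨_, ⟨v, hv, rfl⟩, w, hw, h.symm⟩
      · rintro ⟨_, ⟨v, hv, rfl⟩, w, hw, h⟩
        exact ⟨v, hv, w, hw, h.symm⟩

/-- The step relation of a primitive recursion with step function `g` and parameter `s a`. -/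
theorem isTest_step {g : ℕ →. ℕ} (hg : IsGraph g) {a i u v : ℕ} (ha : a < b) (hi : i < b)
    (hu : u < b) (hv : v < b) :
    IsTest b fun s => s v ∈ g (Nat.pair (s a) (Nat.pair (s i) (s u))) :=
  (IsTest.exists (χ := fun s p => p = Nat.pair (s i) (s u) ∧
      ∃ q, q = Nat.pair (s a) p ∧ s v ∈ g q)
    ((isTest_pair (x := i) (y := u) (z := b) (by omega) (by omega) (by omega)).and
      (IsTest.exists (χ := fun s q => q = Nat.pair (s a) (s b) ∧ s v ∈ g q)
        ((isTest_pair (x := a) (y := b) (z := b + 1) (by omega) (by omega) (by omega)).and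
          (hg (b + 2) (b + 1) v (by omega) (by omega)))
        (fun s q => by simp [show a ≠ b + 1 by omega, show v ≠ b + 1 by omega])))
    (fun s p => by simp [ha.ne, hi.ne, hu.ne, hv.ne])).congr fun s => by simp

theorem IsGraph.prec {f g : ℕ →. ℕ} (hf : IsGraph f) (hg : IsGraph g) :
    IsGraph (Nat.unpaired fun a n =>
      n.rec (f a) fun y IH => do
        let i ← IH
        g (Nat.pair a (Nat.pair y i))) := fun b x y hx hy =>
  (IsTest.exists (χ := fun s a => ∃ n, s x = Nat.pair a n ∧ ∃ r₀, r₀ ∈ f a ∧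
      ∃ r : ℕ → ℕ, r 0 = r₀ ∧ (∀ i < n, r (i + 1) ∈ g (Nat.pair a (Nat.pair i (r i)))) ∧
        r n = s y)
    (IsTest.exists (χ := fun s n => s x = Nat.pair (s b) n ∧ ∃ r₀, r₀ ∈ f (s b) ∧
        ∃ r : ℕ → ℕ, r 0 = r₀ ∧ (∀ i < n, r (i + 1) ∈ g (Nat.pair (s b) (Nat.pair i (r i)))) ∧
          r n = s y)
      ((isTest_pair (x := b) (y := b + 1) (z := x) (by omega) (by omega) (by omega)).and
        (IsTest.exists (χ := fun s r₀ => r₀ ∈ f (s b) ∧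
            ∃ r : ℕ → ℕ, r 0 = r₀ ∧ (∀ i < s (b + 1),
              r (i + 1) ∈ g (Nat.pair (s b) (Nat.pair i (r i)))) ∧ r (s (b + 1)) = s y)
          ((hf (b + 3) b (b + 2) (by omega) (by omega)).and
            (isTest_iterate (ψ := fun s i u v => v ∈ g (Nat.pair (s b) (Nat.pair i u)))
              (b := b + 3) (a := b + 2) (n := b + 1) (y := y)
              (isTest_step hg (by omega) (by omega) (by omega) (by omega))
              (fun s s' h => by simp only [h b (by omega)]) (by omega) (by omega) (by omega)))
          (fun s r₀ => by simp [show y ≠ b + 2 by omega, show b ≠ b + 1 + 1 by omega])))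
      (fun s n => by simp [show x ≠ b + 1 by omega, show y ≠ b + 1 by omega]))
    (fun s a => by simp [hx.ne, hy.ne])).congr fun s => by
      rw [Nat.unpaired, mem_rec_iff f fun i u => g (Nat.pair _ (Nat.pair i u))]
      constructor
      · rintro ⟨a, n, h, h1⟩
        rw [h, Nat.unpair_pair]
        exact h1
      · intro h
        exact ⟨_, _, (Nat.pair_unpair _).symm, h⟩

theorem IsGraph.rfind {f : ℕ →. ℕ} (hf : IsGraph f) :
    IsGraph fun a => Nat.rfind fun n => (fun m => m = 0) <$> f (Nat.pair a n) := by
  intro b x y hx hy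
  have hz : IsTest b fun s => ∃ p, p = Nat.pair (s x) (s y) ∧ ∃ z, z = 0 ∧ z ∈ f p :=
    IsTest.exists (χ := fun s p => p = Nat.pair (s x) (s y) ∧ ∃ z, z = 0 ∧ z ∈ f p)
      ((isTest_pair (x := x) (y := y) (z := b) (by omega) (by omega) (by omega)).and
        (IsTest.exists (χ := fun s z => z = 0 ∧ z ∈ f (s b))
          ((isTest_zero (b + 1)).and (hf (b + 2) b (b + 1) (by omega) (by omega)))
          (fun s z => by simp)))
      (fun s p => by simp [hx.ne, hy.ne])
  -- The values below `y` are scanned by iterating over the constant sequence zero.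
  have hnz : IsTest (b + 4) fun s => s (b + 3) = 0 ∧ ∃ p, p = Nat.pair (s x) (s (b + 1)) ∧
      ∃ t, ∃ w, w = t + 1 ∧ w ∈ f p :=
    (isTest_zero (b + 3)).and
      (IsTest.exists (χ := fun s p => p = Nat.pair (s x) (s (b + 1)) ∧
          ∃ t, ∃ w, w = t + 1 ∧ w ∈ f p)
        ((isTest_pair (x := x) (y := b + 1) (z := b + 4) (by omega) (by omega) (by omega)).and
          (IsTest.exists (χ := fun s t => ∃ w, w = t + 1 ∧ w ∈ f (s (b + 4)))
            (IsTest.exists (χ := fun s w => w = s (b + 5) + 1 ∧ w ∈ f (s (b + 4)))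
              ((isTest_succ (x := b + 5) (y := b + 6) (by omega) (by omega)).and
                (hf (b + 7) (b + 4) (b + 6) (by omega) (by omega)))
              (fun s w => by simp))
            (fun s t => by simp)))
        (fun s p => by simp [show x ≠ b + 4 by omega]))
  refine (hz.and (IsTest.exists (χ := fun s z₀ => z₀ = 0 ∧ ∃ r : ℕ → ℕ, r 0 = z₀ ∧
      (∀ i < s y, r (i + 1) = 0 ∧ ∃ p, p = Nat.pair (s x) i ∧ ∃ t, ∃ w, w = t + 1 ∧ w ∈ f p) ∧
        r (s y) = z₀)
    ((isTest_zero b).and (isTest_iterate (b := b + 1) (a := b) (n := y) (y := b)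
      (ψ := fun s i _ v => v = 0 ∧ ∃ p, p = Nat.pair (s x) i ∧ ∃ t, ∃ w, w = t + 1 ∧ w ∈ f p)
      hnz (fun s s' h => by simp only [h x (by omega)]) (by omega) (by omega) (by omega)))
    (fun s z₀ => by simp [hx.ne, hy.ne]))).congr fun s => ?_
  refine Iff.trans ?_ Nat.mem_rfind.symm
  constructor
  · rintro ⟨⟨_, rfl, _, rfl, h0⟩, _, rfl, r, -, h1, -⟩
    refine ⟨?_, fun {m} hm => ?_⟩
    · simpa using h0
    · obtain ⟨-, _, rfl, t, _, rfl, h2⟩ := h1 m hm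
      simpa using ⟨_, h2, Nat.succ_ne_zero _⟩
  · rintro ⟨h0, h1⟩
    refine ⟨⟨_, rfl, 0, rfl, by simpa using h0⟩, 0, rfl, fun _ => 0, rfl, fun i hi => ⟨rfl, ?_⟩,
      rfl⟩
    have h2 := h1 hi
    simp only [Part.map_eq_map, Part.mem_map_iff, decide_eq_false_iff_not] at h2
    obtain ⟨w, hw, h3⟩ := h2
    obtain ⟨t, rfl⟩ := Nat.exists_eq_succ_of_ne_zero h3
    exact ⟨_, rfl, t, _, rfl, hw⟩

/-- The graphs of all partial recursive functions can be tested. -/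
theorem isGraph_of_partrec {f : ℕ →. ℕ} (h : Nat.Partrec f) : IsGraph f := by
  induction h with
  | zero => exact fun b x y _ _ => (isTest_zero y).congr fun s => by simp [pure, PFun.pure]
  | succ => exact fun b x y hx hy => (isTest_succ hx hy).congr fun s => by simp
  | left =>
    exact fun b x y hx hy => (IsTest.exists (χ := fun s v => s x = Nat.pair (s y) v)
      (isTest_pair (x := y) (y := b) (z := x) (by omega) (by omega) (by omega))
      (fun s v => by simp [hx.ne, hy.ne])).congr fun s => by
        constructor
        · rintro ⟨v, h⟩; simp [h]
        · intro h
          refine ⟨(s x).unpair.2, ?_⟩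
          have h1 : s y = (s x).unpair.1 := by simpa using h
          rw [h1, Nat.pair_unpair]
  | right =>
    exact fun b x y hx hy => (IsTest.exists (χ := fun s v => s x = Nat.pair v (s y))
      (isTest_pair (x := b) (y := y) (z := x) (by omega) (by omega) (by omega))
      (fun s v => by simp [hx.ne, hy.ne])).congr fun s => by
        constructor
        · rintro ⟨v, h⟩; simp [h]
        · intro h
          refine ⟨(s x).unpair.1, ?_⟩
          have h1 : s y = (s x).unpair.2 := by simpa using h
          rw [h1, Nat.pair_unpair]
  | pair _ _ hf hg => exact hf.pair hg
  | comp _ _ hf hg => exact hf.comp hg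
  | prec _ _ hf hg => exact hf.prec hg
  | rfind _ hf => exact hf.rfind

/-- Every recursively enumerable set of natural numbers is the set of inputs, given in the counter
`0`, from which some program can terminate. -/
theorem exists_prog_of_partrec {f : ℕ →. ℕ} (h : Nat.Partrec f) :
    ∃ P : Prog, ∀ n s', Exec P (Pi.single 0 n) s' ↔ s' = Pi.single 0 n ∧ (f n).Dom := by
  obtain ⟨P, hP⟩ := IsTest.exists (b := 1) (χ := fun s v => v ∈ f (s 0))
    (isGraph_of_partrec h 2 0 1 (by omega) (by omega)) (fun s v => by simp)
  refine ⟨P, fun n s' => ?_⟩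
  rw [hP _ fun i hi => Pi.single_eq_of_ne (by omega) _]
  simp [Part.dom_iff_mem]

end Prog

/-! ### Finite control for regular expressions over token moves -/

namespace RegularExpression

variable {α β S : Type*}

/-- Substitution of regular expressions for the letters. -/
def bind (f : α → RegularExpression β) : RegularExpression α → RegularExpression β
  | 0 => 0
  | 1 => 1
  | char a => f a
  | P + Q => P.bind f + Q.bind f
  | P * Q => P.bind f * Q.bind f
  | star P => star (P.bind f)

theorem rel_bind (step : β → S → S → Prop) (f : α → RegularExpression β)
    (P : RegularExpression α) : (P.bind f).rel step = P.rel fun a => (f a).rel step := by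
  induction P with
  | zero => rfl
  | epsilon => rfl
  | char a => rfl
  | plus P Q hP hQ => simp only [bind, rel, hP, hQ]
  | comp P Q hP hQ => simp only [bind, rel, hP, hQ]
  | star P hP => simp only [bind, rel, hP]

/-- All letters of the expression satisfy `p`. -/
def AllLetters (p : α → Prop) : RegularExpression α → Prop
  | 0 => True
  | 1 => True
  | char a => p a
  | P + Q => P.AllLetters p ∧ Q.AllLetters p
  | P * Q => P.AllLetters p ∧ Q.AllLetters p
  | star P => P.AllLetters p

theorem exists_forall_allLetters {p : ℕ → α → Prop} (hp : ∀ a, ∃ k, ∀ l ≥ k, p l a)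
    (P : RegularExpression α) : ∃ k, ∀ l ≥ k, P.AllLetters (p l) := by
  have aux : ∀ {A B : ℕ → Prop}, (∃ k, ∀ l ≥ k, A l) → (∃ k, ∀ l ≥ k, B l) →
      ∃ k, ∀ l ≥ k, A l ∧ B l := by
    rintro A B ⟨k, hk⟩ ⟨l, hl⟩
    exact ⟨max k l, fun m hm => ⟨hk m (le_of_max_le_left hm), hl m (le_of_max_le_right hm)⟩⟩
  induction P with
  | zero => exact ⟨0, fun _ _ => trivial⟩
  | epsilon => exact ⟨0, fun _ _ => trivial⟩
  | char a => exact hp a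
  | plus P Q hP hQ => exact aux hP hQ
  | comp P Q hP hQ => exact aux hP hQ
  | star P hP => exact hP

end RegularExpression

/-- The token move that consumes `a.1` and produces `a.2`. -/
def moveStep {D : Type*} (a : (D → ℕ) × (D → ℕ)) (δ δ' : D → ℕ) : Prop :=
  a.1 ≤ δ ∧ δ' = δ - a.1 + a.2

namespace Rule

variable {C C' D : Type*}

/-- The rule that only changes the control state. -/
def silent (p q : C) : Rule C D := ⟨p, 0, q, 0⟩

/-- Renaming of the control states. -/
def map (f : C → C') (r : Rule C D) : Rule C' D := ⟨f r.src, r.pre, f r.tgt, r.post⟩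

/-- A property that every rule preserves is preserved by runs. -/
theorem Run.invariant {E : Set (Rule C D)} {I : C → (D → ℕ) → Prop}
    (hI : ∀ r ∈ E, ∀ δ, r.pre ≤ δ → I r.src δ → I r.tgt (δ - r.pre + r.post))
    {a b : C × (D → ℕ)} (h : Run E a b) (ha : I a.1 a.2) : I b.1 b.2 := by
  induction h with
  | refl => exact ha
  | tail _ h1 ih =>
    obtain ⟨r, hr, h2, h3, h4, h5⟩ := h1
    rw [← h4, h5]
    exact hI r hr _ h3 (h2 ▸ ih)

theorem Run.map {E : Set (Rule C D)} {E' : Set (Rule C' D)} {f : C → C'}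
    (hf : ∀ r ∈ E, r.map f ∈ E') {p q : C} {δ δ' : D → ℕ} (h : Run E (p, δ) (q, δ')) :
    Run E' (f p, δ) (f q, δ') := by
  refine Relation.ReflTransGen.lift (fun a : C × (D → ℕ) => (f a.1, a.2)) ?_ _ _ h
  rintro a b ⟨r, hr, h1, h2, h3, h4⟩
  exact ⟨r.map f, hf r hr, congrArg f h1, h2, congrArg f h3, h4⟩

theorem Run.silent {E : Set (Rule C D)} {p q : C} (h : silent p q ∈ E) (δ : D → ℕ) :
    Run E (p, δ) (q, δ) :=
  .single ⟨_, h, rfl, fun _ => Nat.zero_le _, rfl, by simp [Rule.silent]⟩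

theorem Run.tail_rule {E : Set (Rule C D)} {a : C × (D → ℕ)} {r : Rule C D} {δ : D → ℕ}
    (h : Run E a (r.src, δ)) (hr : r ∈ E) (hδ : r.pre ≤ δ) :
    Run E a (r.tgt, δ - r.pre + r.post) :=
  h.tail ⟨r, hr, rfl, hδ, rfl, rfl⟩

open RegularExpression

/-- A regular expression over token moves is realized by a finite control (Thompson's
construction). -/
theorem exists_control {D : Type} (P : RegularExpression ((D → ℕ) × (D → ℕ))) :
    ∃ (Q : Type) (_ : Finite Q) (E : Set (Rule Q D)) (p q : Q), E.Finite ∧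
      ∀ δ δ', Run E (p, δ) (q, δ') ↔ P.rel moveStep δ δ' := by
  induction P with
  | zero =>
    refine ⟨Bool, inferInstance, ∅, false, true, Set.finite_empty, fun δ δ' => ?_⟩
    constructor
    · intro h
      exact absurd (Run.invariant (I := fun c _ => c = false) (by simp) h rfl) (by simp)
    · exact False.elim
  | epsilon =>
    refine ⟨Unit, inferInstance, ∅, (), (), Set.finite_empty, fun δ δ' => ?_⟩
    constructor
    · intro h
      exact Run.invariant (I := fun _ δ' => δ = δ') (by simp) h rfl
    · rintro rfl
      exact .refl
  | char a =>
    refine ⟨Bool, inferInstance, {⟨false, a.1, true, a.2⟩}, false, true, Set.finite_singleton _,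
      fun δ δ' => ?_⟩
    constructor
    · intro h
      refine Run.invariant (I := fun c δ' => cond c (moveStep a δ δ') (δ' = δ)) ?_ h rfl
      rintro r rfl δ' h1 rfl
      exact ⟨h1, rfl⟩
    · rintro ⟨h1, rfl⟩
      exact Run.tail_rule (r := ⟨false, a.1, true, a.2⟩) .refl rfl h1
  | plus P P' h h' =>
    obtain ⟨Q, _, E, p, q, hE, hP⟩ := h
    obtain ⟨Q', _, E', p', q', hE', hP'⟩ := h'
    refine ⟨(Q ⊕ Q') ⊕ Bool, inferInstance, Rule.map (.inl ∘ .inl) '' E ∪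
      Rule.map (.inl ∘ .inr) '' E' ∪ {silent (.inr false) (.inl (.inl p)),
        silent (.inr false) (.inl (.inr p')), silent (.inl (.inl q)) (.inr true),
        silent (.inl (.inr q')) (.inr true)}, .inr false, .inr true,
      ((hE.image _).union (hE'.image _)).union (Set.toFinite _), fun δ δ' => ?_⟩
    constructor
    · intro h
      refine Run.invariant (I := fun c δ' => Sum.elim (Sum.elim (fun x => Run E (p, δ) (x, δ'))
        (fun x => Run E' (p', δ) (x, δ'))) (fun c => cond c
          (P.rel moveStep δ δ' ∨ P'.rel moveStep δ δ') (δ = δ')) c) ?_ h rfl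
      rintro r ((⟨r, hr, rfl⟩ | ⟨r, hr, rfl⟩) | rfl | rfl | rfl | rfl) δ' h1 h2
      · exact Run.tail_rule h2 hr h1
      · exact Run.tail_rule h2 hr h1
      · obtain rfl : δ = δ' := h2
        exact .refl
      · obtain rfl : δ = δ' := h2
        exact .refl
      · exact .inl ((hP _ _).1 h2)
      · exact .inr ((hP' _ _).1 h2)
    · rintro (h | h)
      · exact ((Run.silent (by simp) δ).trans (Run.map (f := .inl ∘ .inl) (fun r hr =>
          .inl (.inl ⟨r, hr, rfl⟩)) ((hP _ _).2 h))).trans (Run.silent (by simp) δ')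
      · exact ((Run.silent (by simp) δ).trans (Run.map (f := .inl ∘ .inr) (fun r hr =>
          .inl (.inr ⟨r, hr, rfl⟩)) ((hP' _ _).2 h))).trans (Run.silent (by simp) δ')
  | comp P P' h h' =>
    obtain ⟨Q, _, E, p, q, hE, hP⟩ := h
    obtain ⟨Q', _, E', p', q', hE', hP'⟩ := h'
    refine ⟨Q ⊕ Q', inferInstance, Rule.map .inl '' E ∪ Rule.map .inr '' E' ∪
      {silent (.inl q) (.inr p')}, .inl p, .inr q',
      ((hE.image _).union (hE'.image _)).union (Set.finite_singleton _), fun δ δ' => ?_⟩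
    constructor
    · intro h
      have key := Run.invariant (I := fun c δ' => Sum.elim (fun x => Run E (p, δ) (x, δ'))
        (fun x => ∃ u, P.rel moveStep δ u ∧ Run E' (p', u) (x, δ')) c) ?_ h .refl
      · obtain ⟨u, h1, h2⟩ := key
        exact ⟨u, h1, (hP' _ _).1 h2⟩
      · rintro r ((⟨r, hr, rfl⟩ | ⟨r, hr, rfl⟩) | rfl) δ' h1 h2
        · exact Run.tail_rule h2 hr h1
        · obtain ⟨u, h3, h4⟩ := h2
          exact ⟨u, h3, Run.tail_rule h4 hr h1⟩
        · exact ⟨_, (hP _ _).1 h2, .refl⟩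
    · rintro ⟨u, h1, h2⟩
      exact ((Run.map (f := Sum.inl) (fun r hr => .inl (.inl ⟨r, hr, rfl⟩)) ((hP _ _).2 h1)).trans
        (Run.silent (by simp) u)).trans
        (Run.map (f := Sum.inr) (fun r hr => .inl (.inr ⟨r, hr, rfl⟩)) ((hP' _ _).2 h2))
  | star P h =>
    obtain ⟨Q, _, E, p, q, hE, hP⟩ := h
    refine ⟨Option Q, inferInstance, Rule.map some '' E ∪
      {silent none (some p), silent (some q) none}, none, none,
      (hE.image _).union (Set.toFinite _), fun δ δ' => ?_⟩
    constructor
    · intro h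
      refine Run.invariant (I := fun c δ' => Option.elim c
        (Relation.ReflTransGen (P.rel moveStep) δ δ')
        (fun x => ∃ u, Relation.ReflTransGen (P.rel moveStep) δ u ∧ Run E (p, u) (x, δ'))) ?_ h
        .refl
      rintro r (⟨r, hr, rfl⟩ | rfl | rfl) δ' h1 h2
      · obtain ⟨u, h3, h4⟩ := h2
        exact ⟨u, h3, Run.tail_rule h4 hr h1⟩
      · exact ⟨δ', h2, .refl⟩
      · obtain ⟨u, h3, h4⟩ := h2
        exact h3.tail ((hP _ _).1 h4)
    · intro h
      change Relation.ReflTransGen _ _ _ at h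
      induction h with
      | refl => exact .refl
      | tail _ h1 ih =>
        exact ((ih.trans (Run.silent (by simp) _)).trans (Run.map (f := some) (fun r hr =>
          .inl ⟨r, hr, rfl⟩) ((hP _ _).2 h1))).trans (Run.silent (by simp) _)

end Rule

/-! ### Simulation of counter programs by token moves -/

namespace Simulation

open RegularExpression Instr Function Place

variable {k : ℕ}

/-- The numbers of tokens on the data places. -/
abbrev Data (k : ℕ) := Place k → ℕ

/-- Incrementing the counter `i` takes a token from its complement. -/
def incMove (i : Fin k) : Data k × Data k := (Pi.single (co i) 1, Pi.single (cnt i) 1)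

/-- Decrementing the counter `i` returns a token to its complement. -/
def decMove (i : Fin k) : Data k × Data k := (Pi.single (cnt i) 1, Pi.single (co i) 1)

/-- The start of a zero test. -/
def tick : Data k × Data k := (0, Pi.single tests 1)

/-- Holding a token of the complement during a zero test; the tokens moved are counted. -/
def hold (i : Fin k) : Data k × Data k :=
  (Pi.single (co i) 1, Pi.single (held i) 1 + Pi.single sum 1)

/-- Returning a held token to the complement. -/
def release (i : Fin k) : Data k × Data k := (Pi.single (held i) 1, Pi.single (co i) 1)

/-- The token moves that simulate an instruction. A zero test of the counter `i` moves any number of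
tokens away from `co i` and then any number back. It moves `cap` tokens away only if `cnt i` is
empty. -/
def gadget (k : ℕ) : Instr → RegularExpression (Data k × Data k)
  | inc i => if h : i < k then char (incMove ⟨i, h⟩) else 0
  | dec i => if h : i < k then char (decMove ⟨i, h⟩) else 0
  | isZero i => if h : i < k then
      char tick * (star (char (hold ⟨i, h⟩)) * star (char (release ⟨i, h⟩))) else 0

/-- The relation between data that is realized by simulating an instruction. -/
abbrev gadgetStep (k : ℕ) (a : Instr) : Data k → Data k → Prop := (gadget k a).rel moveStep

/-- The data after a zero test of the counter `i` that moved `a` tokens away and `b` back. -/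
def afterTest (δ : Data k) (i : Fin k) (a b : ℕ) : Data k := fun p =>
  if p = tests then δ p + 1 else if p = sum then δ p + a else if p = co i then δ p - a + b
  else if p = held i then δ p + a - b else δ p

theorem rel_isZero {i : Fin k} {δ δ' : Data k} :
    (char tick * (star (char (hold i)) * star (char (release i)))).rel moveStep δ δ' ↔
      ∃ a b, a ≤ δ (co i) ∧ b ≤ δ (held i) + a ∧ δ' = afterTest δ i a b := by
  have hlt : ∀ n m : ℕ, (∀ t < n, t < m) ↔ n ≤ m := fun n m =>
    ⟨fun h => by
      by_contra hc
      exact lt_irrefl m (h m (by omega)), fun h t ht => ht.trans_le h⟩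
  have h1 : ∀ a u, (char (hold i)).rel moveStep (afterTest δ i a 0) u ↔
      a < δ (co i) ∧ u = afterTest δ i (a + 1) 0 := by
    intro a u
    simp only [rel_char, moveStep, hold, WalkNet.single_le_iff]
    refine and_congr (by simp [afterTest]; omega) (Eq.congr_right ?_)
    funext p
    cases p <;> simp [afterTest, Pi.single_apply]
    all_goals (try split_ifs) <;> omega
  have h2 : ∀ a b u, (char (release i)).rel moveStep (afterTest δ i a b) u ↔
      b < δ (held i) + a ∧ u = afterTest δ i a (b + 1) := by
    intro a b u
    simp only [rel_char, moveStep, release, WalkNet.single_le_iff]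
    refine and_congr (by simp [afterTest]; omega) (Eq.congr_right ?_)
    funext p
    cases p <;> simp [afterTest, Pi.single_apply]
    all_goals (try split_ifs) <;> omega
  have h0 : ∀ u, (char tick).rel moveStep δ u ↔ u = afterTest δ i 0 0 := by
    intro u
    simp only [rel_char, moveStep, tick]
    have : (0 : Data k) ≤ δ := fun _ => Nat.zero_le _
    simp only [this, true_and]
    refine Eq.congr_right ?_
    funext p
    cases p <;> simp [afterTest]
  have l1 : ∀ u, _ ↔ _ := fun u => Relation.reflTransGen_iff_of_iterate (h1) (s' := u)
  have l2 : ∀ a u, _ ↔ _ := fun a u => Relation.reflTransGen_iff_of_iterate (h2 a) (s' := u)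
  simp only [hlt] at l1 l2
  simp only [rel_mul, h0, exists_eq_left, rel_star, l1]
  constructor
  · rintro ⟨_, ⟨a, ha, rfl⟩, h⟩
    obtain ⟨b, hb, rfl⟩ := (l2 a δ').1 h
    exact ⟨a, b, ha, hb, rfl⟩
  · rintro ⟨a, b, ha, hb, rfl⟩
    exact ⟨_, ⟨a, ha, rfl⟩, (l2 a _).2 ⟨b, hb, rfl⟩⟩

/-- The values of the counters, those from `k` on being zero. -/
def counters (δ : Data k) (i : ℕ) : ℕ := if h : i < k then δ (cnt ⟨i, h⟩) else 0

/-- The invariant of the simulation: every counter holds `cap` tokens together with its complement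
and the held tokens. -/
def Balanced (δ : Data k) : Prop := ∀ i, δ (cnt i) + δ (co i) + δ (held i) = δ cap

/-- The relation `R` between data is a sound simulation of the relation `T` between counter values:
in zero tests at most `cap` tokens are moved, and `T` is only guaranteed to hold if exactly that
number has been moved. -/
def Sound (R : Data k → Data k → Prop) (T : (ℕ → ℕ) → (ℕ → ℕ) → Prop) : Prop :=
  ∀ δ δ', R δ δ' → Balanced δ → Balanced δ' ∧ δ' cap = δ cap ∧
    δ' sum + δ cap * δ tests ≤ δ sum + δ cap * δ' tests ∧
    (δ' sum + δ cap * δ tests = δ sum + δ cap * δ' tests → T (counters δ) (counters δ'))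

/-- At most `cap` tokens are moved in a zero test. If exactly `cap` tokens are moved, the complement
held all of them, so the counter was zero and no token was held before. -/
theorem sound_gadget (a : Instr) : Sound (gadgetStep k a) (a.step) := by
  intro δ δ' h hδ
  rcases a with i | i | i <;> simp only [gadgetStep, gadget] at h <;> split_ifs at h with hi
  · obtain ⟨h1, rfl⟩ := h
    have h1 : δ (co ⟨i, hi⟩) ≠ 0 := WalkNet.single_le_iff.1 h1
    refine ⟨fun j => ?_, by simp [incMove], by simp [incMove], fun _ => ?_⟩
    · have h2 := hδ j
      by_cases hj : j = ⟨i, hi⟩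
      · subst hj; simp [incMove]; omega
      · simp [incMove, hj]; omega
    · funext j
      rw [update_apply]
      by_cases hj : j = i
      · subst hj; simp [counters, incMove, hi]
      · by_cases hjk : j < k <;> simp [counters, incMove, hj, hjk]
  · exact h.elim
  · obtain ⟨h1, rfl⟩ := h
    have h1 : δ (cnt ⟨i, hi⟩) ≠ 0 := WalkNet.single_le_iff.1 h1
    refine ⟨fun j => ?_, by simp [decMove], by simp [decMove],
      fun _ => ⟨by simpa [counters, hi] using h1, ?_⟩⟩
    · have h2 := hδ j
      by_cases hj : j = ⟨i, hi⟩
      · subst hj; simp [decMove]; omega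
      · simp [decMove, hj]; omega
    · funext j
      rw [update_apply]
      by_cases hj : j = i
      · subst hj; simp [counters, decMove, hi]
      · by_cases hjk : j < k <;> simp [counters, decMove, hj, hjk]
  · exact h.elim
  · obtain ⟨a, b, ha, hb, rfl⟩ := rel_isZero.1 h
    have h2 := hδ ⟨i, hi⟩
    refine ⟨fun j => ?_, by simp [afterTest], ?_, fun h3 => ⟨?_, ?_⟩⟩
    · have h2 := hδ j
      by_cases hj : j = ⟨i, hi⟩
      · subst hj; simp [afterTest]; omega
      · simp [afterTest, hj]; omega
    · simp [afterTest, mul_add]; omega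
    · simp [afterTest, mul_add] at h3
      simp only [counters, hi, dif_pos]
      omega
    · funext j
      simp [counters, afterTest]
  · exact h.elim

theorem sound_rel (P : Prog) : Sound (P.rel (gadgetStep k)) P.Exec := by
  have htrans : ∀ {c s s' s'' t t' t'' : ℕ}, s' + c * t ≤ s + c * t' →
      s'' + c * t' ≤ s' + c * t'' → s'' + c * t ≤ s + c * t'' ∧
      (s'' + c * t = s + c * t'' → s' + c * t = s + c * t' ∧ s'' + c * t' = s' + c * t'') := by
    intros; omega
  induction P with
  | zero => exact fun _ _ h => h.elim
  | epsilon => rintro δ _ rfl hδ; exact ⟨hδ, rfl, le_rfl, fun _ => rfl⟩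
  | char a => exact sound_gadget a
  | plus P Q hP hQ =>
    rintro δ δ' (h | h) hδ
    · obtain ⟨h1, h2, h3, h4⟩ := hP _ _ h hδ
      exact ⟨h1, h2, h3, fun h => .inl (h4 h)⟩
    · obtain ⟨h1, h2, h3, h4⟩ := hQ _ _ h hδ
      exact ⟨h1, h2, h3, fun h => .inr (h4 h)⟩
  | comp P Q hP hQ =>
    rintro δ δ' ⟨u, h, h'⟩ hδ
    obtain ⟨h1, h2, h3, h4⟩ := hP _ _ h hδ
    obtain ⟨h1', h2', h3', h4'⟩ := hQ _ _ h' h1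
    rw [h2] at h2' h3' h4'
    obtain ⟨h5, h6⟩ := htrans h3 h3'
    exact ⟨h1', h2', h5, fun h => ⟨_, h4 (h6 h).1, h4' (h6 h).2⟩⟩
  | star P hP =>
    intro δ δ' h hδ
    change Relation.ReflTransGen _ _ _ at h
    induction h with
    | refl => exact ⟨hδ, rfl, le_rfl, fun _ => .refl⟩
    | tail _ h ih =>
      obtain ⟨h1, h2, h3, h4⟩ := ih
      obtain ⟨h1', h2', h3', h4'⟩ := hP _ _ h h1
      rw [h2] at h2' h3' h4'
      obtain ⟨h5, h6⟩ := htrans h3 h3'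
      exact ⟨h1', h2', h5, fun h => Relation.ReflTransGen.tail (h4 (h6 h).1) (h4' (h6 h).2)⟩

/-- The data that represents the counter values `s` with capacity `K`, where `S`, `T` and `x` are
the numbers of tokens on `sum`, `tests` and `walk`. -/
def encode (k : ℕ) (K S T x : ℕ) (s : ℕ → ℕ) : Data k
  | cap => K
  | sum => S
  | tests => T
  | walk => x
  | clock => 0
  | cnt i => s i
  | co i => K - s i
  | held _ => 0

/-- The relation `R` between data is a complete simulation of the relation `T` between counter
values: for all large capacities `K` it can be realized with `n` zero tests that move `K` tokens
each. -/
def Complete (R : Data k → Data k → Prop) (T : (ℕ → ℕ) → (ℕ → ℕ) → Prop) : Prop :=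
  ∀ s s', T s s' → ∃ K₀, ∀ K ≥ K₀, ∃ n, ∀ S U x,
    R (encode k K S U x s) (encode k K (S + K * n) (U + n) x s')

/-- The counter used by an instruction. -/
def _root_.Instr.reg : Instr → ℕ
  | inc i => i
  | dec i => i
  | isZero i => i

theorem complete_gadget {a : Instr} (ha : a.reg < k) : Complete (gadgetStep k a) a.step := by
  rintro s s' h
  rcases a with i | i | i <;> have hi : i < k := ha <;>
    simp only [gadgetStep, gadget, hi, dif_pos]
  · obtain rfl : s' = _ := h
    refine ⟨s i + 1, fun K hK => ⟨0, fun S U x => ⟨WalkNet.single_le_iff.2 ?_, ?_⟩⟩⟩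
    · simp only [encode]; omega
    · funext p
      cases p with
      | cnt j =>
        by_cases hj : j = ⟨i, hi⟩
        · subst hj; simp [encode, incMove]
        · simp [encode, incMove, hj, Fin.ext_iff.not.1 hj]
      | co j =>
        by_cases hj : j = ⟨i, hi⟩
        · subst hj; simp [encode, incMove]; omega
        · simp [encode, incMove, hj, Fin.ext_iff.not.1 hj]
      | _ => simp [encode, incMove]
  · obtain ⟨h0, rfl⟩ := h
    refine ⟨s i, fun K hK => ⟨0, fun S U x => ⟨WalkNet.single_le_iff.2 h0, ?_⟩⟩⟩
    funext p
    cases p with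
    | cnt j =>
      by_cases hj : j = ⟨i, hi⟩
      · subst hj; simp [encode, decMove]
      · simp [encode, decMove, hj, Fin.ext_iff.not.1 hj]
    | co j =>
      by_cases hj : j = ⟨i, hi⟩
      · subst hj; simp [encode, decMove]; omega
      · simp [encode, decMove, hj, Fin.ext_iff.not.1 hj]
    | _ => simp [encode, decMove]
  · obtain ⟨h0, rfl⟩ := h
    refine ⟨0, fun K _ => ⟨1, fun S U x => rel_isZero.2 ⟨K, K, ?_, ?_, ?_⟩⟩⟩
    · simp [encode, h0]
    · simp [encode]
    · funext p
      cases p with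
      | co j =>
        by_cases hj : j = ⟨i, hi⟩
        · subst hj; simp [encode, afterTest, h0]
        · simp [encode, afterTest, hj]
      | held j => simp [encode, afterTest]
      | _ => simp [encode, afterTest]

theorem complete_rel {P : Prog} (hP : P.AllLetters fun a => a.reg < k) :
    Complete (P.rel (gadgetStep k)) P.Exec := by
  have htrans : ∀ {R R' : Data k → Data k → Prop} {s s' s'' : ℕ → ℕ},
      (∃ K₀, ∀ K ≥ K₀, ∃ n, ∀ S U x,
        R (encode k K S U x s) (encode k K (S + K * n) (U + n) x s')) →
      (∃ K₀, ∀ K ≥ K₀, ∃ n, ∀ S U x,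
        R' (encode k K S U x s') (encode k K (S + K * n) (U + n) x s'')) →
      ∃ K₀, ∀ K ≥ K₀, ∃ n, ∀ S U x, ∃ u, R (encode k K S U x s) u ∧
        R' u (encode k K (S + K * n) (U + n) x s'') := by
    rintro R R' s s' s'' ⟨K₁, h₁⟩ ⟨K₂, h₂⟩
    refine ⟨max K₁ K₂, fun K hK => ?_⟩
    obtain ⟨n₁, h₁⟩ := h₁ K (le_of_max_le_left hK)
    obtain ⟨n₂, h₂⟩ := h₂ K (le_of_max_le_right hK)
    refine ⟨n₁ + n₂, fun S U x => ⟨_, h₁ S U x, ?_⟩⟩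
    rw [mul_add, ← add_assoc, ← add_assoc]
    exact h₂ _ _ _
  induction P with
  | zero => exact fun _ _ h => h.elim
  | epsilon => rintro s _ rfl; exact ⟨0, fun K _ => ⟨0, fun S U x => rfl⟩⟩
  | char a => exact complete_gadget hP
  | plus P Q ihP ihQ =>
    rintro s s' (h | h)
    · obtain ⟨K₀, h⟩ := ihP hP.1 _ _ h
      refine ⟨K₀, fun K hK => ?_⟩
      obtain ⟨n, h⟩ := h K hK
      exact ⟨n, fun S U x => .inl (h S U x)⟩
    · obtain ⟨K₀, h⟩ := ihQ hP.2 _ _ h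
      refine ⟨K₀, fun K hK => ?_⟩
      obtain ⟨n, h⟩ := h K hK
      exact ⟨n, fun S U x => .inr (h S U x)⟩
  | comp P Q ihP ihQ =>
    rintro s s' ⟨u, h, h'⟩
    exact htrans (ihP hP.1 _ _ h) (ihQ hP.2 _ _ h')
  | star P ihP =>
    intro s s' h
    change Relation.ReflTransGen _ _ _ at h
    induction h with
    | refl => exact ⟨0, fun K _ => ⟨0, fun S U x => .refl⟩⟩
    | tail _ h ih =>
      obtain ⟨K₀, h⟩ := htrans ih (ihP hP _ _ h)
      refine ⟨K₀, fun K hK => ?_⟩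
      obtain ⟨n, h⟩ := h K hK
      refine ⟨n, fun S U x => ?_⟩
      obtain ⟨u, h1, h2⟩ := h S U x
      exact Relation.ReflTransGen.tail h1 h2

/-- Increasing the capacity. -/
def grow : Data k × Data k :=
  (0, fun
    | cap => 1
    | co _ => 1
    | _ => 0)

/-- Moving the starting point of the random walk upwards. -/
def lengthen : Data k × Data k := (0, Pi.single walk 1)

/-- The simulation of the program `P`, after a choice of the capacity and of the starting point of
the random walk. -/
def simulation (k : ℕ) (P : Prog) : RegularExpression (Data k × Data k) :=
  star (char grow) * (star (char lengthen) * P.bind (gadget k))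

theorem rel_simulation {P : Prog} {n : ℕ} {s : ℕ → ℕ} (hs : ∀ i, s i ≤ n) {δ : Data k} :
    (simulation k P).rel moveStep (encode k n 0 0 0 s) δ ↔
      ∃ j x, P.rel (gadgetStep k) (encode k (n + j) 0 0 x s) δ := by
  have h1 : ∀ j u, (char grow).rel moveStep (encode k (n + j) 0 0 0 s) u ↔
      True ∧ u = encode k (n + (j + 1)) 0 0 0 s := by
    intro j u
    have h0 : (0 : Data k) ≤ encode k (n + j) 0 0 0 s := fun _ => Nat.zero_le _
    simp only [rel_char, moveStep, grow, h0, true_and]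
    refine Eq.congr_right ?_
    funext p
    cases p with
    | co i => have := hs i; simp [encode]; omega
    | _ => simp [encode]; try omega
  have h2 : ∀ j x u, (char lengthen).rel moveStep (encode k (n + j) 0 0 x s) u ↔
      True ∧ u = encode k (n + j) 0 0 (x + 1) s := by
    intro j x u
    have h0 : (0 : Data k) ≤ encode k (n + j) 0 0 x s := fun _ => Nat.zero_le _
    simp only [rel_char, moveStep, lengthen, h0, true_and]
    refine Eq.congr_right ?_
    funext p
    cases p <;> simp [encode]
  have l1 : ∀ u, _ ↔ _ := fun u => Relation.reflTransGen_iff_of_iterate h1 (s' := u)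
  have l2 : ∀ j u, _ ↔ _ := fun j u => Relation.reflTransGen_iff_of_iterate (h2 j) (s' := u)
  simp only [add_zero] at l1
  simp only [simulation, rel_mul, rel_star, l1, rel_bind]
  constructor
  · rintro ⟨_, ⟨j, -, rfl⟩, u, h, h'⟩
    obtain ⟨x, -, rfl⟩ := (l2 j u).1 h
    exact ⟨j, x, h'⟩
  · rintro ⟨j, x, h⟩
    exact ⟨_, ⟨j, by simp, rfl⟩, _, (l2 j _).2 ⟨x, by simp, rfl⟩, h⟩

theorem balanced_encode {K S T x : ℕ} {s : ℕ → ℕ} (hs : ∀ i, s i ≤ K) :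
    Balanced (encode k K S T x s) := by
  intro i
  have := hs i
  simp [encode]
  omega

/-- If the program cannot terminate, every run of the simulation misses some tokens in its zero
tests. -/
theorem sum_lt_of_simulation {P : Prog} {n : ℕ} {s : ℕ → ℕ} (hs : ∀ i, s i ≤ n)
    (hk : ∀ i, k ≤ i → s i = 0) (hP : ∀ s', ¬ P.Exec s s') {δ : Data k}
    (h : (simulation k P).rel moveStep (encode k n 0 0 0 s) δ) : δ sum < δ cap * δ tests := by
  obtain ⟨j, x, h⟩ := (rel_simulation hs).1 h
  obtain ⟨-, h1, h2, h3⟩ := sound_rel P _ _ h (balanced_encode fun i => (hs i).trans (by omega))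
  have h4 : counters (encode k (n + j) 0 0 x s) = s := by
    funext i
    by_cases hi : i < k
    · simp [counters, encode, hi]
    · simp [counters, hi, hk i (by omega)]
  rw [h4] at h3
  rw [h1]
  simp only [encode, mul_zero, add_zero, zero_add] at h2 h3 ⊢
  exact lt_of_le_of_ne h2 fun h => hP _ (h3 h)

/-- If the program can terminate, some run of the simulation moves all tokens in its zero tests, and
then starts the random walk at any prescribed point. -/
theorem exists_simulation {P : Prog} (hP : P.AllLetters fun a => a.reg < k) {n : ℕ}
    {s s' : ℕ → ℕ} (hs : ∀ i, s i ≤ n) (h : P.Exec s s') :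
    ∃ K T, ∀ x, (simulation k P).rel moveStep (encode k n 0 0 0 s) (encode k K (K * T) T x s') := by
  obtain ⟨K₀, h⟩ := complete_rel hP _ _ h
  obtain ⟨T, h⟩ := h (n + K₀) (by omega)
  refine ⟨n + K₀, T, fun x => (rel_simulation hs).2 ⟨K₀, x, ?_⟩⟩
  simpa using h 0 0 x

end Simulation

/-! ### The reduction -/

namespace Simulation

open RegularExpression Place WalkNet Rule

/-- Every recursively enumerable set is decided by the decisiveness of a fixed net, for initial
markings that depend in a primitive recursive way on the input. The target marking is fixed, and its
upward closure serves equally well. -/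
theorem exists_net_of_partrec {f : ℕ →. ℕ} (hf : Nat.Partrec f) :
    ∃ (c : NetCode) (l : ℕ → List ℕ) (A : List (List ℕ)), Primrec l ∧
      (∀ n, (netOf c).markovChain.Decisive (vecOf c.1 (l n)) (finiteSetOf c.1 A) ↔ ¬(f n).Dom) ∧
      ∀ n, (netOf c).markovChain.Decisive (vecOf c.1 (l n)) (upwardClosedSetOf c.1 A) ↔
        ¬(f n).Dom := by
  classical
  obtain ⟨P, hP⟩ := Prog.exists_prog_of_partrec hf
  obtain ⟨k₀, hk₀⟩ := exists_forall_allLetters (p := fun k (a : Instr) => a.reg < k)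
    (fun a => ⟨a.reg + 1, fun l hl => by omega⟩) P
  -- At least one counter is present, so that `counters` recovers the input.
  let k := k₀ + 1
  have hk : P.AllLetters fun a => a.reg < k := hk₀ _ (by omega)
  obtain ⟨Q, _, E', p, q, hE', hrun⟩ := exists_control (simulation k P)
  have : Fintype Q := Fintype.ofFinite Q
  let E := hE'.toFinset
  have hE : (E : Set (Rule Q (Place k))) = E' := hE'.coe_toFinset
  let e : Ctl Q ⊕ Place k ≃ Fin (Fintype.card (Ctl Q ⊕ Place k)) := Fintype.equivFin _
  let d := Fintype.card (Ctl Q ⊕ Place k)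
  obtain ⟨L, hL1, hL2⟩ := exists_netOf (walkNet e E q)
  have hchain : (netOf (d, L)).markovChain = (walkNet e E q).markovChain :=
    PolyPPN.markovChain_congr hL1 fun t ht => hL2 t (hL1 ▸ ht)
  -- The input is given in the counter `0`; its value is also the initial capacity.
  let s : ℕ → ℕ → ℕ := fun n => Pi.single 0 n
  have hs : ∀ n i, s n i ≤ n := fun n i => by
    by_cases hi : i = 0
    · simp [s, hi]
    · simp [s, hi]
  let m : ℕ → Marking d := fun n => marking e (.run p) (encode k n 0 0 0 (s n))
  let A : List (List ℕ) := [List.ofFn (marking e .drain (0 : Place k → ℕ))]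
  have key : ∀ n (T : Set (Marking d)), IsTarget e T →
      ((walkNet e E q).markovChain.Decisive (m n) T ↔ ¬(f n).Dom) := by
    intro n T hT
    rw [MarkovChain.decisive_iff]
    constructor
    · intro h0 hdom
      obtain ⟨K, U, h⟩ := exists_simulation hk (hs n) ((hP n (s n)).2 ⟨rfl, hdom⟩)
      -- The starting point of the walk is so high that it returns to zero with small probability.
      obtain ⟨x, hx⟩ := exists_pow_lt_of_lt_one (show (0 : ℝ) < 2 / 3 by norm_num)
        (show ((2 * (K * U) + 1) / (2 * (K * U) + 2) : ℝ) < 1 by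
          rw [div_lt_one (by positivity)]; linarith)
      refine (stay_run_pos E q hT (q₀ := p) (δ₀ := encode k n 0 0 0 (s n))
        (δ := encode k K (K * U) U x (s n)) ?_ rfl rfl hx).ne' h0
      rw [hE]
      exact (hrun _ _).2 (h x)
    · intro hdom
      refine stay_run E q hT fun δ hδ => ?_
      rw [hE] at hδ
      exact sum_lt_of_simulation (hs n) (fun i hi => Pi.single_eq_of_ne (by omega) _)
        (fun s' h => hdom ((hP n s').1 h).2) ((hrun _ _).1 hδ)
  refine ⟨(d, L), fun n => List.ofFn (m n), A, Primrec.list_ofFn fun j => ?_, fun n => ?_,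
    fun n => ?_⟩
  · simp only [marking]
    rcases e.symm j with c | pl
    · exact Primrec.const _
    · cases pl with
      | cap => exact Primrec.id
      | cnt i =>
        by_cases hi : (i : ℕ) = 0
        · simp only [encode, s, hi, Pi.single_eq_same, Sum.elim_inr]
          exact Primrec.id
        · simpa [encode, s, hi] using Primrec.const 0
      | co i =>
        by_cases hi : (i : ℕ) = 0
        · simpa [encode, s, hi] using Primrec.const 0
        · simp only [encode, s, hi, Pi.single_eq_of_ne, Sum.elim_inr, ne_eq, not_false_eq_true,
            Nat.sub_zero]
          exact Primrec.id
      | _ => exact Primrec.const 0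
  · rw [hchain, vecOf_ofFn]
    refine key n _ ⟨⟨_, List.mem_singleton_self _, vecOf_ofFn _⟩, ?_⟩
    rintro κ δ ⟨l, hl, h⟩
    rw [List.mem_singleton.1 hl, vecOf_ofFn] at h
    exact ((marking_inj e).1 h).1.symm
  · rw [hchain, vecOf_ofFn]
    refine key n _ ⟨⟨_, List.mem_singleton_self _, (vecOf_ofFn _).le⟩, ?_⟩
    rintro κ δ ⟨l, hl, h⟩
    rw [List.mem_singleton.1 hl, vecOf_ofFn] at h
    exact ((marking_le_iff e).1 h).1.symm

end Simulation

end

theorem mainTheorem1 :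
    (¬ ComputablePred fun I : InstanceCode =>
      (netOf I.1.1).markovChain.Decisive (vecOf I.1.1.1 I.1.2) (finiteSetOf I.1.1.1 I.2)) ∧
    (¬ ComputablePred fun I : InstanceCode =>
      (netOf I.1.1).markovChain.Decisive (vecOf I.1.1.1 I.1.2)
        (upwardClosedSetOf I.1.1.1 I.2)) := by
  have hf : Partrec fun n : ℕ => (Denumerable.ofNat Nat.Partrec.Code n).eval 0 :=
    Nat.Partrec.Code.eval_part.comp (Computable.ofNat _) (Computable.const 0)
  obtain ⟨c, l, A, hl, h1, h2⟩ := Simulation.exists_net_of_partrec (Partrec.nat_iff.1 hf)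
  have hc : Computable fun code : Nat.Partrec.Code =>
      (((c, l (Encodable.encode code)), A) : InstanceCode) :=
    (((Computable.const c).pair (hl.to_comp.comp Computable.encode)).pair (Computable.const A))
  constructor <;> intro h
  · refine ComputablePred.halting_problem 0 ((ComputablePred.computable_of_manyOneReducible
      ⟨_, hc, fun code => ?_⟩ h.not))
    change _ ↔ ¬ (netOf c).markovChain.Decisive _ _
    rw [h1, not_not, Denumerable.ofNat_encode]
  · refine ComputablePred.halting_problem 0 ((ComputablePred.computable_of_manyOneReducible
      ⟨_, hc, fun code => ?_⟩ h.not))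
    change _ ↔ ¬ (netOf c).markovChain.Decisive _ _
    rw [h2, not_not, Denumerable.ofNat_encode]
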